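/- Let $M$ be a closed oriented smooth $3$-manifold with $H_1(M;\mathbb Z)=0$, and let $G=G_{V_1,V_2}$ be a balanced bipartite spatial graph in $M$: a finite bipartite graph with non-empty vertex classes $V_1,V_2$, $|V_1|=|V_2|$, edge set $E$ (parallel edges allowed), without isolated vertices, smoothly embedded in $M$ and considered up to isotopy. Suppose that the graph $G$ is connected. A Heegaard diagram $(\Sigma,\boldsymbol\alpha,\boldsymbol\beta,\boldsymbol z)$ of $G$ consists of a closed connected oriented surface $\Sigma$ of genus $g$; tuples $\boldsymbol\alpha=\{\alpha_1,\dots,\alpha_{d_1}\}$ and $\boldsymbol\beta=\{\beta_1,\dots,\beta_{d_2}\}$ of oriented smooth simple closed curves on $\Sigma$, the curves in each tuple being pairwise disjoint and $\boldsymbol\alpha\cap\boldsymbol\beta$ being finite (for instance, transverse); and a tuple $\boldsymbol z$ of $|E|$ distinct points of $\Sigma\setminus(\boldsymbol\alpha\cup\boldsymbol\beta)$ (basepoints), labelled by the edges; where $|V_i|=d_i-g+1$ for $i=1,2$ (so $d_1=d_2$), such that: 1. attaching $2$-handles to $\Sigma\times[-1,0]$ along $\boldsymbol\alpha\times\{-1\}$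 and to $\Sigma\times[0,1]$ along $\boldsymbol\beta\times\{1\}$ makes the boundary components other than $\Sigma\times\{0\}$ into $|V_1|$, respectively $|V_2|$, two-spheres, and after capping these off with $3$-balls the union $\overline{U_{\boldsymbol\alpha}}\cup_{\Sigma\times\{0\}}\overline{U_{\boldsymbol\beta}}$ of the two resulting handlebodies is $M$, the orientation of $\Sigma$ being the one induced as boundary of $U_{\boldsymbol\alpha}$; 2. for each $v\in V_1$ there is an embedded star in $\Sigma\setminus\boldsymbol\alpha$ whose legs run from a centre to the basepoints of the edges at $v$, and for each $u\in V_2$ there is such a star in $\Sigma\setminus\boldsymbol\beta$; the stars of distinct vertices of the same class are disjoint; each component of $\Sigma\setminus\boldsymbol\alpha$ contains the star of exactly one $v\in V_1$, and each component of $\Sigma\setminus\boldsymbol\beta$ that of exactly one $u\in V_2$; 3. the union of all stars, those of $V_1$ pushed slightly into $\overline{U_{\boldsymbol\alpha}}$ and those of $V_2$ into $\overline{U_{\boldsymbol\beta}}$ with the basepoints fixed, is $G$ (up to ambient isotopy, respecting vertices and edges). A domain is an integral combination $P=\sum_i a_iD_i$ of the closures $D_i$ of the components of $\Sigma\setminus(\boldsymbol\alpha\cup\boldsymbol\beta)$.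 It is periodic if $\partial P$ is an integral combination of $\boldsymbol\alpha$-curves and $\boldsymbol\beta$-curves and the local multiplicity of $P$ at every basepoint is $0$. The diagram is admissible if every non-zero periodic domain has both a positive and a negative coefficient. Then, for every Heegaard diagram of $G$, the only periodic domain is $P=0$. Hence every Heegaard diagram of $G$ is admissible. -/

import Mathlib

open Set Filter Topology CategoryTheory
open scoped Manifold ContDiff

noncomputable section

namespace SpatialHeegaard

universe u v

/-! ### Homology, orientations, arcs -/

/-- The first singular homology group of `X` with integer coefficients. -/
def H1 (X : Type u) [TopologicalSpace X] : ModuleCat.{u} ℤ :=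
  ((AlgebraicTopology.singularHomologyFunctor (ModuleCat.{u} ℤ) 1).obj
    (ModuleCat.of ℤ (ULift.{u} ℤ))).obj (TopCat.of X)

/-- An orientation of a smooth `n`-manifold: an orientation of every tangent space, locally
constant when read in the local trivializations of the tangent bundle given by the charts. -/
structure ManifoldOrientation (n : ℕ) (X : Type u) [TopologicalSpace X]
    [ChartedSpace (EuclideanSpace ℝ (Fin n)) X] [IsManifold (𝓡 n) ∞ X] where
  at_ : ∀ x : X, Orientation ℝ (TangentSpace (𝓡 n) x) (Fin n)
  locally_constant : ∀ x₀ : X, ∃ o : Orientation ℝ (EuclideanSpace ℝ (Fin n)) (Fin n),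
    haveI : IsManifold (𝓡 n) 1 X := IsManifold.of_le (n := ∞) (by norm_cast)
    ∀ᶠ x in 𝓝 x₀,
      ∀ hx : x ∈ (trivializationAt (EuclideanSpace ℝ (Fin n))
          (TangentSpace (𝓡 n) : X → Type) x₀).baseSet,
        Orientation.map (Fin n)
          ((trivializationAt (EuclideanSpace ℝ (Fin n))
            (TangentSpace (𝓡 n) : X → Type) x₀).linearEquivAt ℝ x hx) (at_ x) = o

/-- `c`, restricted to `[0,1]`, is a smoothly embedded (regular, simple) arc. -/
structure IsSmoothArc (n : ℕ) {X : Type u} [TopologicalSpace X]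
    [ChartedSpace (EuclideanSpace ℝ (Fin n)) X] (c : ℝ → X) : Prop where
  smooth : ContMDiffOn 𝓘(ℝ, ℝ) (𝓡 n) ∞ c (Icc 0 1)
  regular : ∀ s ∈ Icc (0 : ℝ) 1, mfderivWithin 𝓘(ℝ, ℝ) (𝓡 n) c (Icc 0 1) s ≠ 0
  injOn : InjOn c (Icc 0 1)

/-! ### Bipartite graphs and bipartite spatial graphs -/

/-- A finite bipartite graph (parallel edges allowed) with non-empty vertex classes `V₁`, `V₂`,
edge set `E` and no isolated vertices. -/
structure BipartiteGraph (V₁ V₂ E : Type) where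
  nonempty₁ : Nonempty V₁
  nonempty₂ : Nonempty V₂
  end₁ : E → V₁
  end₂ : E → V₂
  no_isolated₁ : Function.Surjective end₁
  no_isolated₂ : Function.Surjective end₂

/-- Two distinct vertices are adjacent when some edge joins them. -/
def BipartiteGraph.toSimpleGraph {V₁ V₂ E : Type} (G : BipartiteGraph V₁ V₂ E) :
    SimpleGraph (V₁ ⊕ V₂) :=
  SimpleGraph.fromRel fun x y => ∃ e, x = Sum.inl (G.end₁ e) ∧ y = Sum.inr (G.end₂ e)

/-- The graph is connected. -/
def BipartiteGraph.IsConnected {V₁ V₂ E : Type} (G : BipartiteGraph V₁ V₂ E) : Prop :=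
  G.toSimpleGraph.Connected

/-- A smooth embedding of a bipartite graph in a `3`-manifold `M`. The arc of an edge runs from
its endpoint in `V₁` (parameter `0`) to its endpoint in `V₂` (parameter `1`). -/
structure SpatialGraph (V₁ V₂ E : Type) (M : Type u) [TopologicalSpace M]
    [ChartedSpace (EuclideanSpace ℝ (Fin 3)) M] extends BipartiteGraph V₁ V₂ E where
  pos₁ : V₁ → M
  pos₂ : V₂ → M
  arc : E → ℝ → M
  pos_injective : Function.Injective (Sum.elim pos₁ pos₂)
  arc_smooth : ∀ e, IsSmoothArc 3 (arc e)
  arc_zero : ∀ e, arc e 0 = pos₁ (end₁ e)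
  arc_one : ∀ e, arc e 1 = pos₂ (end₂ e)
  arc_interior : ∀ e, ∀ s ∈ Ioo (0 : ℝ) 1, arc e s ∉ range pos₁ ∪ range pos₂
  arc_disjoint : ∀ e e', e ≠ e' → Disjoint (arc e '' Ioo 0 1) (arc e' '' Ioo 0 1)

/-! ### Pointed diagrams on a surface, domains, periodic domains, admissibility -/

section Diagram

variable {S : Type v} [TopologicalSpace S] [ChartedSpace (EuclideanSpace ℝ (Fin 2)) S]

/-- The union of a family of closed curves. -/
def curveUnion {d : ℕ} (γ : Fin d → Circle → S) : Set S := ⋃ i, range (γ i)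

/-- A two-sided collar (open tubular neighbourhood) `Circle × ℝ ≅ nbhd` of the closed curve `γ`. -/
structure IsCollar (γ : Circle → S) (a : Circle × ℝ → S) : Prop where
  localDiffeo : IsLocalDiffeomorph ((𝓡 1).prod 𝓘(ℝ, ℝ)) (𝓡 2) ∞ a
  injective : Function.Injective a
  core : ∀ θ, a (θ, 0) = γ θ

end Diagram

/-- An oriented smooth surface with two tuples `α`, `β` of oriented smooth simple closed curves
(each tuple pairwise disjoint; `α` and `β` meet in finitely many points) and a tuple `z` of
basepoints off the curves. -/
structure PointedDiagram (S : Type v) [TopologicalSpace S]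
    [ChartedSpace (EuclideanSpace ℝ (Fin 2)) S] [IsManifold (𝓡 2) ∞ S] (d₁ d₂ m : ℕ) where
  orientation : ManifoldOrientation 2 S
  α : Fin d₁ → Circle → S
  β : Fin d₂ → Circle → S
  z : Fin m → S
  α_embedding : ∀ i, Manifold.IsSmoothEmbedding (𝓡 1) (𝓡 2) ∞ (α i)
  β_embedding : ∀ j, Manifold.IsSmoothEmbedding (𝓡 1) (𝓡 2) ∞ (β j)
  α_disjoint : ∀ i i', i ≠ i' → Disjoint (range (α i)) (range (α i'))
  β_disjoint : ∀ j j', j ≠ j' → Disjoint (range (β j)) (range (β j'))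
  finite_inter : (curveUnion α ∩ curveUnion β).Finite
  z_injective : Function.Injective z
  z_mem : ∀ k, z k ∉ curveUnion α ∪ curveUnion β

namespace PointedDiagram

variable {S : Type v} [TopologicalSpace S] [ChartedSpace (EuclideanSpace ℝ (Fin 2)) S]
  [IsManifold (𝓡 2) ∞ S] {d₁ d₂ m : ℕ} (D : PointedDiagram S d₁ d₂ m)

/-- The complement of all the curves. -/
def complement : Set S := (curveUnion D.α ∪ curveUnion D.β)ᶜ

/-- A domain: an integral combination of the (closures of the) connected components of the
complement of the curves, given by its coefficients. -/
abbrev Domain : Type v := ConnectedComponents D.complement → ℤ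

open Classical in
/-- The local multiplicity `n_p(P)` at a point off the curves (and `0` at points on them). -/
def mult (P : D.Domain) (p : S) : ℤ :=
  if h : p ∈ D.complement then P (ConnectedComponents.mk ⟨p, h⟩) else 0

/-- The boundary of `P` runs along the curve `γ` with one and the same multiplicity everywhere:
in a collar `a` of `γ`, the multiplicities of `P` on the two sides of `γ` differ by a constant
`c`, at all points of `γ` off the set `other` of points on the curves of the other family. (The
choice of the collar only affects the sign of `c`.) -/
def BoundaryConstantAlong (P : D.Domain) (γ : Circle → S) (other : Set S) : Prop :=
  ∀ a : Circle × ℝ → S, IsCollar γ a → ∃ c : ℤ, ∀ θ : Circle, γ θ ∉ other →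
    ∀ᶠ t : ℝ in 𝓝[>] 0, D.mult P (a (θ, t)) - D.mult P (a (θ, -t)) = c

/-- A periodic domain: its boundary is an integral combination of whole `α`- and `β`-curves, and
its multiplicity at every basepoint is zero. -/
structure IsPeriodic (P : D.Domain) : Prop where
  along_α : ∀ i, D.BoundaryConstantAlong P (D.α i) (curveUnion D.β)
  along_β : ∀ j, D.BoundaryConstantAlong P (D.β j) (curveUnion D.α)
  basepoints : ∀ k, D.mult P (D.z k) = 0

/-- Every non-trivial periodic domain has both positive and negative coefficients. -/
def IsAdmissible : Prop :=
  ∀ P : D.Domain, D.IsPeriodic P → P ≠ 0 → (∃ x, 0 < P x) ∧ (∃ x, P x < 0)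

end PointedDiagram

/-! ### Attaching 2-handles and 3-balls -/

section Handlebody

variable {S : Type v} [TopologicalSpace S] [ChartedSpace (EuclideanSpace ℝ (Fin 2)) S]
  {M : Type u} [TopologicalSpace M]

/-- Given an embedding `C` of `S × ℝ` in `M`, the data exhibiting a subset of `M` as the result of
attaching to `S × [-1, 0]` one 2-handle `D² × [-1, 1]` along each curve `γ i × {-1}`, and of capping
off the boundary components other than `S × {0}`, which are `k` two-spheres, with `k` three-balls.
The closed disk `D²` is the closed unit disk in `ℂ`. -/
structure HandleFilling (C : S × ℝ → M) {d : ℕ} (γ : Fin d → Circle → S) (k : ℕ) where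
  /-- the attaching annulus of the `i`-th handle is `annulus i (Circle × [-1, 1]) × {-1}` -/
  annulus : Fin d → Circle × ℝ → S
  annulus_collar : ∀ i, IsCollar (γ i) (annulus i)
  annulus_disjoint : ∀ i i', i ≠ i' →
    Disjoint (annulus i '' (univ ×ˢ Icc (-1) 1)) (annulus i' '' (univ ×ˢ Icc (-1) 1))
  handle : Fin d → ℂ × ℝ → M
  handle_continuous : ∀ i, ContinuousOn (handle i) (Metric.closedBall 0 1 ×ˢ Icc (-1) 1)
  handle_injective : ∀ i, InjOn (handle i) (Metric.closedBall 0 1 ×ˢ Icc (-1) 1)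
  handle_attach : ∀ i, ∀ θ : Circle, ∀ t ∈ Icc (-1 : ℝ) 1,
    handle i ((θ : ℂ), t) = C (annulus i (θ, t), -1)
  handle_disjoint_collar : ∀ i, Disjoint
    (handle i '' (Metric.ball 0 1 ×ˢ Icc (-1) 1)) (C '' (univ ×ˢ Icc (-1) 0))
  handle_disjoint : ∀ i i', i ≠ i' →
    Disjoint (handle i '' (Metric.closedBall 0 1 ×ˢ Icc (-1) 1))
      (handle i' '' (Metric.closedBall 0 1 ×ˢ Icc (-1) 1))
  cap : Fin k → EuclideanSpace ℝ (Fin 3) → M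
  cap_continuous : ∀ l, ContinuousOn (cap l) (Metric.closedBall 0 1)
  cap_injective : ∀ l, InjOn (cap l) (Metric.closedBall 0 1)
  cap_disjoint : ∀ l l', l ≠ l' →
    Disjoint (cap l '' Metric.closedBall 0 1) (cap l' '' Metric.closedBall 0 1)
  cap_interior : ∀ l, Disjoint (cap l '' Metric.ball 0 1)
    (C '' (univ ×ˢ Icc (-1) 0) ∪
      ⋃ i, handle i '' (Metric.closedBall 0 1 ×ˢ Icc (-1) 1))
  /-- the bounding spheres of the balls are the boundary, other than `S × {0}`, of the result of
  the handle attachments -/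
  cap_attach : (⋃ l, cap l '' Metric.sphere 0 1) =
    C '' ((⋃ i, annulus i '' (univ ×ˢ Ioo (-1) 1))ᶜ ×ˢ {-1}) ∪
      ⋃ i, handle i '' (Metric.closedBall 0 1 ×ˢ {-1, 1})

/-- The handlebody: `S × [-1, 0]` with the 2-handles and the 3-balls. -/
def HandleFilling.carrier {C : S × ℝ → M} {d : ℕ} {γ : Fin d → Circle → S} {k : ℕ}
    (F : HandleFilling C γ k) : Set M :=
  C '' (univ ×ˢ Icc (-1) 0) ∪
    (⋃ i, F.handle i '' (Metric.closedBall 0 1 ×ˢ Icc (-1) 1)) ∪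
    ⋃ l, F.cap l '' Metric.closedBall 0 1

/-- Disjoint embedded stars on `S` off the curves `γ`, one for each vertex `v` of a vertex class
`V`: the star of `v` has one leg for each edge at `v`, from its centre to the basepoint of the edge.
Each component of the complement of `γ` contains the star of exactly one vertex. -/
structure Stars {d : ℕ} (γ : Fin d → Circle → S) {V E : Type} (endpt : E → V) (z : E → S) where
  center : V → S
  leg : E → ℝ → S
  leg_smooth : ∀ e, IsSmoothArc 2 (leg e)
  leg_zero : ∀ e, leg e 0 = center (endpt e)
  leg_one : ∀ e, leg e 1 = z e
  leg_off : ∀ e, ∀ s ∈ Icc (0 : ℝ) 1, leg e s ∉ curveUnion γ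
  leg_disjoint : ∀ e e', e ≠ e' → ∀ s ∈ Icc (0 : ℝ) 1, ∀ s' ∈ Icc (0 : ℝ) 1,
    leg e s = leg e' s' → s = 0 ∧ s' = 0 ∧ endpt e = endpt e'
  component : ∀ p ∉ curveUnion γ, ∃! v, p ∈ connectedComponentIn (curveUnion γ)ᶜ (center v)

end Handlebody

/-! ### Heegaard diagrams of a balanced bipartite spatial graph -/

section HeegaardDiagram

variable {S : Type v} [TopologicalSpace S] [ChartedSpace (EuclideanSpace ℝ (Fin 2)) S]
  [IsManifold (𝓡 2) ∞ S]
  {M : Type u} [TopologicalSpace M] [ChartedSpace (EuclideanSpace ℝ (Fin 3)) M]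
  [IsManifold (𝓡 3) ∞ M]

/-- `C : S × ℝ → M` is orientation preserving: a positive basis of a tangent space of `S` followed
by the positive direction of `ℝ` is sent to a positive basis of a tangent space of `M`. -/
def PreservesOrientation (oS : ManifoldOrientation 2 S) (oM : ManifoldOrientation 3 M)
    (C : S × ℝ → M) : Prop :=
  ∀ (p : S) (t : ℝ) (b : Module.Basis (Fin 2) ℝ (TangentSpace (𝓡 2) p))
    (b' : Module.Basis (Fin 3) ℝ (TangentSpace (𝓡 3) (C (p, t)))),
    b.orientation = oS.at_ p →
    b' 0 = mfderiv (𝓡 2) (𝓡 3) (fun q => C (q, t)) p (b 0) →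
    b' 1 = mfderiv (𝓡 2) (𝓡 3) (fun q => C (q, t)) p (b 1) →
    b' 2 = mfderiv 𝓘(ℝ, ℝ) (𝓡 3) (fun s : ℝ => C (p, s)) t (1 : ℝ) →
    b'.orientation = oM.at_ (C (p, t))

/-- The data exhibiting `D` as a Heegaard diagram, on a surface of genus `g`, of the bipartite
spatial graph `G` in the oriented `3`-manifold `M`. -/
structure HeegaardPresentation {d₁ d₂ m : ℕ} (D : PointedDiagram S d₁ d₂ m)
    (oM : ManifoldOrientation 3 M) {V₁ V₂ E : Type} [Fintype V₁] [Fintype V₂]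
    (G : SpatialGraph V₁ V₂ E M) (g : ℕ) where
  genus : Module.finrank ℤ (H1 S) = 2 * g
  card₁ : Fintype.card V₁ + g = d₁ + 1
  card₂ : Fintype.card V₂ + g = d₂ + 1
  /-- the embedding of `S × ℝ`, whose part `S × [-1, 1]` carries the handle attachments -/
  C : S × ℝ → M
  C_localDiffeo : IsLocalDiffeomorph ((𝓡 2).prod 𝓘(ℝ, ℝ)) (𝓡 3) ∞ C
  C_injective : Function.Injective C
  C_orientation : PreservesOrientation D.orientation oM C
  /-- the handlebody on the negative side, with 2-handles along `α × {-1}` -/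
  Uα : HandleFilling C D.α (Fintype.card V₁)
  /-- the handlebody on the positive side, with 2-handles along `β × {1}` -/
  Uβ : HandleFilling (fun q => C (q.1, -q.2)) D.β (Fintype.card V₂)
  cover : Uα.carrier ∪ Uβ.carrier = univ
  inter : Uα.carrier ∩ Uβ.carrier = C '' (univ ×ˢ {0})
  /-- basepoints correspond to edges -/
  label : E ≃ Fin m
  stars₁ : Stars D.α G.end₁ (fun e => D.z (label e))
  stars₂ : Stars D.β G.end₂ (fun e => D.z (label e))
  /-- an ambient isotopy from the union of the pushed-in stars to `G` -/
  isotopy : unitInterval → M ≃ₜ M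
  isotopy_continuous : Continuous fun q : unitInterval × M => isotopy q.1 q.2
  isotopy_zero : isotopy 0 = Homeomorph.refl M
  isotopy_vertex₁ : ∀ v, isotopy 1 (C (stars₁.center v, -(1 / 2))) = G.pos₁ v
  isotopy_vertex₂ : ∀ v, isotopy 1 (C (stars₂.center v, 1 / 2)) = G.pos₂ v
  isotopy_edge : ∀ e, isotopy 1 ''
      ((fun s : ℝ => C (stars₁.leg e s, -((1 - s) / 2))) '' Icc 0 1 ∪
        (fun s : ℝ => C (stars₂.leg e s, (1 - s) / 2)) '' Icc 0 1) = G.arc e '' Icc 0 1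

/-- `D` is a Heegaard diagram of the bipartite spatial graph `G` in the oriented `M`. -/
def IsHeegaardDiagram {d₁ d₂ m : ℕ} (D : PointedDiagram S d₁ d₂ m)
    (oM : ManifoldOrientation 3 M) {V₁ V₂ E : Type} [Fintype V₁] [Fintype V₂]
    (G : SpatialGraph V₁ V₂ E M) : Prop :=
  ∃ g : ℕ, Nonempty (HeegaardPresentation D oM G g)

end HeegaardDiagram

end SpatialHeegaard

end

noncomputable section

namespace SpatialHeegaard

universe u v


/-! ### Circle-valued maps on a space with vanishing first homology -/

/-! Homologically, the boundary of a periodic domain P splits into an α-part and a β-part; each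
bounds in its own handlebody, and together with P they form a closed surface in M. Since H₁(M) = 0,
this surface has zero intersection number with every loop. The proof replaces the surface by its
dual map Φ : M → ℝ/ℤ, so no duality theorem or general position is needed.

Let n be the multiplicity function, with jumps cα, cβ along the curves. Each curve has a collar step
function that is discontinuous in ℝ but continuous mod 1; let eα, eβ be the weighted sums. Then h =
n + eα + eβ extends to a continuous real function, also at the crossings of the curves
(`exists_continuous_eq_add_stepSum`). Mod 1, eα extends over the handlebody on its side: it becomes
c · ramp along the core direction of each 2-handle and 0 on the balls. The same holds for -eβ. As h
is real-valued, eα - (t + 1)h interpolates on S × [-1, 0] between eα and eα - h ≡ -eβ, so everything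
glues to Φ (`exists_circleMap_of_fillings`).

Because H₁(M) = 0, the pullback of Φ to S × ℝ lifts to a real function L
(`exists_lift_of_isZero_H1`), and L(p, -1) - L(p, 1) = h(p). Hence n = fα - fβ with fα = L(·, -1) -
eα and fβ = L(·, 1) + eβ. These are integer-valued and continuous off the α-curves and the β-curves
respectively, hence locally constant there (`HeegaardPresentation.exists_mult_eq_sub`).

So fα is a labelling of V₁ and fβ one of V₂. Vanishing of n at the basepoint of an edge says that
its two ends have equal labels. Connectedness of the graph makes all labels equal, and since every
component of either complement carries a star, n = 0. -/

lemma AddCircle.exists_lift_of_contractible {A : Type*} [TopologicalSpace A] [ContractibleSpace A]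
    (f : C(A, AddCircle (1 : ℝ))) : ∃ g : C(A, ℝ), ∀ a, (g a : AddCircle (1 : ℝ)) = f a := by
  obtain ⟨a₀, ⟨H⟩⟩ := id_nullhomotopic A
  have cov := AddCircle.isCoveringMap_coe (1 : ℝ)
  obtain ⟨r, hr⟩ := QuotientAddGroup.mk_surjective (f a₀)
  -- The contraction run backwards: K starts at the constant `f a₀`, which lifts to the constant r,
  -- and ends at f. The lift of f is the end of the lifted homotopy.
  let K : C(unitInterval × A, AddCircle (1 : ℝ)) := f.comp H.symm.toContinuousMap
  have hK : ∀ a, K (0, a) = (((ContinuousMap.const A r) a : ℝ) : AddCircle (1 : ℝ)) := by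
    intro a
    simp only [K, ContinuousMap.comp_apply]
    have : H.symm.toContinuousMap (0, a) = a₀ := by
      exact H.symm.apply_zero a
    rw [this]
    exact hr.symm
  refine ⟨(cov.liftHomotopy K (ContinuousMap.const A r) hK).comp
    ((ContinuousMap.const A 1).prodMk (ContinuousMap.id A)), fun a => ?_⟩
  have := congrFun (cov.liftHomotopy_lifts K (ContinuousMap.const A r) hK) (1, a)
  simp only [Function.comp_apply] at this
  change (((cov.liftHomotopy K (ContinuousMap.const A r) hK) (1, a) : ℝ) : AddCircle (1 : ℝ)) = f a
  rw [this]
  simp only [K, ContinuousMap.comp_apply]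
  congr 1
  exact H.symm.apply_one a

/-- Two lifts of the same circle-valued map have the same increments. -/
lemma AddCircle.lift_sub_eq {A : Type*} [TopologicalSpace A] [PreconnectedSpace A]
    {g g' : A → ℝ} (hg : Continuous g) (hg' : Continuous g')
    (h : ∀ a, (g a : AddCircle (1 : ℝ)) = (g' a : AddCircle (1 : ℝ))) (a b : A) :
    g b - g a = g' b - g' a := by
  have cov := AddCircle.isCoveringMap_coe (1 : ℝ)
  have hga : ((g a - g' a : ℝ) : AddCircle (1 : ℝ)) = 0 := by
    rw [AddCircle.coe_sub, h, sub_self]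
  -- `g a - g' a` is an integer, so the shifted g' is again a lift and agrees with g at a; lifts on
  -- a connected space are unique.
  have := cov.eq_of_comp_eq (g₁ := g) (g₂ := fun x => g' x + (g a - g' a)) hg (by fun_prop)
    (by ext x; simp only [Function.comp_apply, AddCircle.coe_add, hga, add_zero, h]) a (by ring)
  have := congrFun this b
  linarith

/-! ### Increments of a circle-valued map as a 1-cocycle on singular chains -/

section Increment

variable {X : Type u} [TopologicalSpace X] (F : C(X, AddCircle (1 : ℝ)))

instance contractibleSpace_stdSimplex (n : ℕ) : ContractibleSpace (stdSimplex ℝ (Fin (n + 1))) :=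
  (convex_stdSimplex ℝ (Fin (n + 1))).contractibleSpace
    ⟨_, single_mem_stdSimplex ℝ (0 : Fin (n + 1))⟩

/-- A real lift of a circle-valued map along a singular simplex. -/
def simplexLift {n : ℕ} (σ : C(stdSimplex ℝ (Fin (n + 1)), X)) : C(stdSimplex ℝ (Fin (n + 1)), ℝ) :=
  (AddCircle.exists_lift_of_contractible (F.comp σ)).choose

lemma simplexLift_spec {n : ℕ} (σ : C(stdSimplex ℝ (Fin (n + 1)), X)) (a) :
    (simplexLift F σ a : AddCircle (1 : ℝ)) = F (σ a) :=
  (AddCircle.exists_lift_of_contractible (F.comp σ)).choose_spec a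

/-- The increment of a circle-valued map along a singular `1`-simplex. -/
def increment (σ : C(stdSimplex ℝ (Fin 2), X)) : ℝ :=
  simplexLift F σ (stdSimplex.vertex 1) - simplexLift F σ (stdSimplex.vertex 0)

/-- A single lift on the large simplex restricts to a lift on each edge, so the increments of all
edges are differences of the vertex values of one function. -/
lemma increment_comp {n : ℕ} (τ : C(stdSimplex ℝ (Fin (n + 1)), X))
    (f : C(stdSimplex ℝ (Fin 2), stdSimplex ℝ (Fin (n + 1)))) :
    increment F (τ.comp f) =
      simplexLift F τ (f (stdSimplex.vertex 1)) - simplexLift F τ (f (stdSimplex.vertex 0)) :=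
  AddCircle.lift_sub_eq (g := simplexLift F (τ.comp f)) (g' := simplexLift F τ ∘ f)
    (by fun_prop) (by fun_prop)
    (fun a => by simp [simplexLift_spec]) _ _

open Simplicial SimplexCategory

/-- The continuous map underlying a singular simplex. -/
def singularMap {n : ℕ} (x : (TopCat.toSSet.obj (TopCat.of X)) _⦋n⦌) :
    C(stdSimplex ℝ (Fin (n + 1)), X) :=
  TopCat.toSSetObjEquiv (TopCat.of X) (Opposite.op ⦋n⦌) x

lemma singularMap_δ {n : ℕ} (x : (TopCat.toSSet.obj (TopCat.of X)) _⦋n + 1⦌) (i : Fin (n + 2)) :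
    singularMap ((TopCat.toSSet.obj (TopCat.of X)).δ i x) =
      (singularMap x).comp ⟨_, stdSimplex.continuous_map (Fin.succAbove i)⟩ := by
  rfl

/-- The integral singular chain complex. -/
abbrev singularChains (X : Type u) [TopologicalSpace X] : ChainComplex (ModuleCat.{u} ℤ) ℕ :=
  (TopCat.toSSet.obj (TopCat.of X)).chainComplex (ModuleCat.of ℤ (ULift.{u} ℤ))

/-- The increment of a circle-valued map, as a homomorphism on singular `1`-chains. -/
def incrementHom : (singularChains X).X 1 ⟶ ModuleCat.of ℤ (ULift.{u} ℝ) :=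
  Limits.Sigma.desc fun x : (TopCat.toSSet.obj (TopCat.of X)) _⦋1⦌ =>
    ModuleCat.ofHom (R := ℤ) (LinearMap.toSpanSingleton ℤ (ULift.{u} ℝ) ⟨increment F (singularMap x)⟩
      ∘ₗ (ULift.moduleEquiv : ULift.{u} ℤ ≃ₗ[ℤ] ℤ).toLinearMap)

/-- The generator of the singular chains given by a singular simplex. -/
def chainGen {n : ℕ} (x : (TopCat.toSSet.obj (TopCat.of X)) _⦋n⦌) : (singularChains X).X n :=
  (SSet.ιChainComplex (R := ModuleCat.of ℤ (ULift.{u} ℤ)) _ x).hom ⟨1⟩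

lemma incrementHom_chainGen (x : (TopCat.toSSet.obj (TopCat.of X)) _⦋1⦌) :
    (incrementHom F).hom (chainGen x) = ⟨increment F (singularMap x)⟩ := by
  have : SSet.ιChainComplex (R := ModuleCat.of ℤ (ULift.{u} ℤ)) _ x ≫ incrementHom F =
      ModuleCat.ofHom (R := ℤ) (LinearMap.toSpanSingleton ℤ (ULift.{u} ℝ) ⟨increment F (singularMap x)⟩
        ∘ₗ (ULift.moduleEquiv : ULift.{u} ℤ ≃ₗ[ℤ] ℤ).toLinearMap) :=
    Limits.Sigma.ι_desc _ _
  have h := congrArg (fun f => f.hom (ULift.up 1)) this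
  simpa [chainGen] using h

lemma d_chainGen {n : ℕ} (x : (TopCat.toSSet.obj (TopCat.of X)) _⦋n + 1⦌) :
    ((singularChains X).d (n + 1) n).hom (chainGen x) =
      ∑ i : Fin (n + 2), (-1 : ℤ) ^ i.val •
        chainGen ((TopCat.toSSet.obj (TopCat.of X)).δ i x) := by
  have h := congrArg (fun f => f.hom (ULift.up 1))
    (SSet.ιChainComplex_d (R := ModuleCat.of ℤ (ULift.{u} ℤ)) _ x)
  dsimp only at h
  rw [ModuleCat.hom_sum, LinearMap.sum_apply] at h
  exact h

/-- The cocycle condition: with one lift on a 2-simplex, the increments around its boundary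
telescope. -/
lemma d_incrementHom : (singularChains X).d 2 1 ≫ incrementHom F = 0 := by
  refine SSet.chainComplex_hom_ext fun x => ModuleCat.hom_ext (LinearMap.ext fun z => ?_)
  have hz : z = z.down • (ULift.up 1 : ULift.{u} ℤ) := by ext; simp
  rw [hz, map_smul, map_smul]
  congr 1
  change (incrementHom F).hom (((singularChains X).d 2 1).hom (chainGen x)) = 0
  have hk : ∀ i : Fin 3, (incrementHom F).hom
      (chainGen ((TopCat.toSSet.obj (TopCat.of X)).δ i x)) =
      ULift.up (simplexLift F (singularMap x) (stdSimplex.vertex (Fin.succAbove i 1)) -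
        simplexLift F (singularMap x) (stdSimplex.vertex (Fin.succAbove i 0))) := by
    intro i
    refine (incrementHom_chainGen F _).trans (congrArg ULift.up ?_)
    rw [singularMap_δ, increment_comp]
    simp only [ContinuousMap.coe_mk, stdSimplex.map_vertex]
  rw [d_chainGen, Fin.sum_univ_three, map_add, map_add, map_zsmul, map_zsmul, map_zsmul]
  erw [hk 0, hk 1, hk 2]
  refine ULift.ext _ _ ?_
  -- The faces are the edges 1→2, 0→2, 0→1, with signs +, -, +.
  have h : ∀ i : Fin 3, Fin.succAbove i (0 : Fin 2) = ![1, 0, 0] i ∧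
      Fin.succAbove i (1 : Fin 2) = ![2, 2, 1] i := by decide
  simp [h]

lemma incrementHom_eq_zero (hX : Limits.IsZero (H1 X)) (c : (singularChains X).X 1)
    (hc : ((singularChains X).d 1 0).hom c = 0) : (incrementHom F).hom c = 0 := by
  have h : (singularChains X).ExactAt 1 :=
    (HomologicalComplex.exactAt_iff_isZero_homology _ _).2 hX
  rw [HomologicalComplex.exactAt_iff' _ 2 1 0 (by simp) (by simp),
    ShortComplex.moduleCat_exact_iff] at h
  obtain ⟨b, rfl⟩ := h c hc
  exact congr(($(d_incrementHom F)).hom b)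

/-- The singular `1`-simplex given by a path. -/
def pathSimplex (γ : C(unitInterval, X)) : (TopCat.toSSet.obj (TopCat.of X)) _⦋1⦌ :=
  (TopCat.toSSetObjEquiv (TopCat.of X) (Opposite.op ⦋1⦌)).symm
    (γ.comp (stdSimplexHomeomorphUnitInterval : C(stdSimplex ℝ (Fin 2), unitInterval)))

lemma singularMap_pathSimplex (γ : C(unitInterval, X)) : singularMap (pathSimplex γ) =
    γ.comp (stdSimplexHomeomorphUnitInterval : C(stdSimplex ℝ (Fin 2), unitInterval)) :=
  Equiv.apply_symm_apply _ _

lemma singularMap_injective {n : ℕ} : Function.Injective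
    (singularMap : (TopCat.toSSet.obj (TopCat.of X)) _⦋n⦌ → _) :=
  (TopCat.toSSetObjEquiv (TopCat.of X) (Opposite.op ⦋n⦌)).injective

lemma increment_pathSimplex (γ : C(unitInterval, X)) (Γ : C(unitInterval, ℝ))
    (h : ∀ t, (Γ t : AddCircle (1 : ℝ)) = F (γ t)) :
    increment F (singularMap (pathSimplex γ)) = Γ 1 - Γ 0 := by
  rw [singularMap_pathSimplex]
  exact AddCircle.lift_sub_eq (g' := Γ ∘ stdSimplexHomeomorphUnitInterval) (by fun_prop)
    (by fun_prop) (fun a => by simp [simplexLift_spec, h]) _ _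

/-- If `H₁(X) = 0`, the increment of a circle-valued map along a path depends only on the
endpoints. -/
lemma increment_eq_of_isZero_H1 (hX : Limits.IsZero (H1 X)) (γ γ' : C(unitInterval, X))
    (h0 : γ 0 = γ' 0) (h1 : γ 1 = γ' 1) (Γ Γ' : C(unitInterval, ℝ))
    (hΓ : ∀ t, (Γ t : AddCircle (1 : ℝ)) = F (γ t))
    (hΓ' : ∀ t, (Γ' t : AddCircle (1 : ℝ)) = F (γ' t)) : Γ 1 - Γ 0 = Γ' 1 - Γ' 0 := by
  -- Equal end points mean equal faces, so the difference of the two path simplices is a 1-cycle, on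
  -- which the increment vanishes.
  have hδ : ∀ i, (TopCat.toSSet.obj (TopCat.of X)).δ i (pathSimplex γ) =
      (TopCat.toSSet.obj (TopCat.of X)).δ i (pathSimplex γ') := by
    intro i
    apply singularMap_injective
    rw [singularMap_δ, singularMap_δ, singularMap_pathSimplex, singularMap_pathSimplex]
    ext a
    have ha : a = stdSimplex.vertex 0 := Subsingleton.elim _ _
    subst ha
    simp only [ContinuousMap.comp_apply, ContinuousMap.coe_mk, stdSimplex.map_vertex]
    fin_cases i
    · exact h1
    · exact h0
  have := incrementHom_eq_zero F hX (chainGen (pathSimplex γ) - chainGen (pathSimplex γ')) (by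
    rw [map_sub, d_chainGen, d_chainGen, sub_eq_zero]
    simp only [hδ])
  rw [map_sub, incrementHom_chainGen, incrementHom_chainGen, increment_pathSimplex F γ Γ hΓ,
    increment_pathSimplex F γ' Γ' hΓ', sub_eq_zero] at this
  exact congrArg ULift.down this

/-- If `H₁(X) = 0`, circle-valued maps that factor through `X` lift to real-valued maps. -/
theorem exists_lift_of_isZero_H1 (hX : Limits.IsZero (H1 X)) {A : Type*} [TopologicalSpace A]
    [PathConnectedSpace A] [LocallyPathConnectedSpace A] (f : C(A, X)) :
    ∃ g : C(A, ℝ), ∀ a, (g a : AddCircle (1 : ℝ)) = F (f a) := by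
  have cov := AddCircle.isCoveringMap_coe (1 : ℝ)
  obtain ⟨a₀⟩ : Nonempty A := inferInstance
  obtain ⟨r, hr⟩ := QuotientAddGroup.mk_surjective (F (f a₀))
  -- The lifting criterion: paths from `a₀` lift, and the end of the lift depends only on the end of
  -- the path. The second condition is where the homology hypothesis enters.
  obtain ⟨g, ⟨-, hg⟩, -⟩ := cov.isLocalHomeomorph.existsUnique_continuousMap_lifts (F.comp f) a₀ r hr
    (fun γ hγ => by
      obtain ⟨Γ, h, h'⟩ := cov.exists_path_lifts ((F.comp f).comp γ) r (by simp [hγ, ← hr])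
      exact ⟨Γ, h', h⟩)
    (fun γ γ' Γ Γ' h0 h0' H0 H0' hΓ hΓ' h1 => by
      have := increment_eq_of_isZero_H1 F hX (f.comp γ) (f.comp γ') (by simp [h0, h0'])
        (by simp [h1]) Γ Γ' (fun t => congrFun hΓ t) (fun t => congrFun hΓ' t)
      linarith)
  exact ⟨g, fun a => congrFun hg a⟩

end Increment


/-! ### Step functions across collars -/

/-- A continuous function rising from `0` at `-1` to `1` at `1`. -/
def ramp (t : ℝ) : ℝ := max 0 (min 1 ((t + 1) / 2))

/-- The difference of the continuous ramp and the unit step at `0`. -/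
def rampStep (t : ℝ) : ℝ := ramp t - if 0 < t then 1 else 0

lemma continuous_ramp : Continuous ramp := by unfold ramp; fun_prop

lemma ramp_of_le {t : ℝ} (h : t ≤ -1) : ramp t = 0 := by
  unfold ramp
  rw [max_eq_left]
  exact (min_le_right _ _).trans (by linarith)

lemma ramp_of_ge {t : ℝ} (h : 1 ≤ t) : ramp t = 1 := by
  unfold ramp
  rw [min_eq_left (by linarith), max_eq_right zero_le_one]

lemma rampStep_eq_zero {t : ℝ} (h : t ∉ Ioo (-1 : ℝ) 1) : rampStep t = 0 := by
  unfold rampStep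
  rcases le_or_gt t (-1) with h1 | h1
  · rw [ramp_of_le h1, if_neg (by linarith), sub_zero]
  · have h2 : 1 ≤ t := by
      by_contra h2
      exact h ⟨h1, not_le.1 h2⟩
    rw [ramp_of_ge h2, if_pos (by linarith), sub_self]

/-- The unit jump is invisible mod 1; this is why the collar functions are continuous into the
circle. -/
lemma coe_rampStep (t : ℝ) : (rampStep t : AddCircle (1 : ℝ)) = ramp t := by
  unfold rampStep
  split_ifs
  · rw [AddCircle.coe_sub, AddCircle.coe_period, sub_zero]
  · rw [sub_zero]

lemma continuousAt_rampStep {t : ℝ} (ht : t ≠ 0) : ContinuousAt rampStep t := by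
  refine continuous_ramp.continuousAt.sub ?_
  rcases lt_or_gt_of_ne ht with h | h
  · refine (continuousAt_const (y := (0 : ℝ))).congr ?_
    filter_upwards [eventually_lt_nhds h] with x hx
    rw [if_neg (not_lt.2 hx.le)]
  · refine (continuousAt_const (y := (1 : ℝ))).congr ?_
    filter_upwards [eventually_gt_nhds h] with x hx
    rw [if_pos hx]

lemma AddCircle.coe_intCast (n : ℤ) : ((n : ℝ) : AddCircle (1 : ℝ)) = 0 := by
  rw [AddCircle.coe_eq_zero_iff]
  exact ⟨n, by simp⟩

lemma coe_intCast_mul (n : ℤ) (x : ℝ) : ((n * x : ℝ) : AddCircle (1 : ℝ)) = n • (x : AddCircle (1 : ℝ)) := by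
  rw [← AddCircle.coe_zsmul, zsmul_eq_mul]

section Collar

variable {S : Type v} [TopologicalSpace S] [ChartedSpace (EuclideanSpace ℝ (Fin 2)) S]
  {γ : Circle → S} {a : Circle × ℝ → S}

lemma IsCollar.isOpenEmbedding (ha : IsCollar γ a) : IsOpenEmbedding a :=
  ha.localDiffeo.isLocalHomeomorph.isOpenEmbedding_of_injective ha.injective

lemma IsCollar.continuous_core (ha : IsCollar γ a) : Continuous γ := by
  have : γ = fun θ => a (θ, 0) := funext fun θ => (ha.core θ).symm
  rw [this]
  exact ha.isOpenEmbedding.continuous.comp (by fun_prop)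

lemma IsCollar.isClosed_range [T2Space S] (ha : IsCollar γ a) : IsClosed (range γ) :=
  (isCompact_range ha.continuous_core).isClosed

lemma IsCollar.mem_range_iff (ha : IsCollar γ a) (q : Circle × ℝ) : a q ∈ range γ ↔ q.2 = 0 := by
  constructor
  · rintro ⟨θ, hθ⟩
    rw [← ha.core] at hθ
    rw [← ha.injective hθ]
  · intro h
    exact ⟨q.1, by rw [← ha.core, ← h]⟩

lemma IsCollar.dense_compl_range (ha : IsCollar γ a) : Dense (range γ)ᶜ := by
  intro p
  by_cases hp : p ∈ range γ
  · obtain ⟨θ, rfl⟩ := hp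
    have h : Tendsto (fun t : ℝ => a (θ, t)) (𝓝[>] 0) (𝓝 (γ θ)) := by
      rw [← ha.core]
      exact ((ha.isOpenEmbedding.continuous.comp (by fun_prop : Continuous fun t : ℝ => (θ, t))
        ).tendsto 0).mono_left nhdsWithin_le_nhds
    refine mem_closure_of_tendsto h ?_
    filter_upwards [self_mem_nhdsWithin] with t ht
    rw [mem_compl_iff, ha.mem_range_iff]
    exact ne_of_gt ht
  · exact subset_closure hp

/-- Extension by zero of a compactly supported function along an open embedding. -/
lemma continuousAt_extend_zero {Y Z S : Type*} [TopologicalSpace Y] [TopologicalSpace S] [T2Space S]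
    [TopologicalSpace Z] [Zero Z] {a : Y → S} (ha : IsOpenEmbedding a) {f : Y → Z} {K : Set Y}
    (hK : IsCompact K) (hf : ∀ y ∉ K, f y = 0) {p : S} (h : ∀ y, a y = p → ContinuousAt f y) :
    ContinuousAt (Function.extend a f 0) p := by
  by_cases hp : p ∈ a '' K
  · obtain ⟨y, -, rfl⟩ := hp
    rw [← ha.continuousAt_iff, Function.extend_comp ha.injective]
    exact h y rfl
  · refine (continuousAt_const (y := (0 : Z))).congr ?_
    filter_upwards [(hK.image ha.continuous).isClosed.isOpen_compl.mem_nhds hp] with x hx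
    by_cases hxa : ∃ y, a y = x
    · obtain ⟨y, rfl⟩ := hxa
      rw [ha.injective.extend_apply, hf]
      exact fun hy => hx (mem_image_of_mem a hy)
    · rw [Function.extend_apply' _ _ _ hxa]; rfl

/-- The step function across a collar: extends the function `rampStep` of the collar coordinate
by zero. -/
def collarStep (a : Circle × ℝ → S) : S → ℝ := Function.extend a (fun q => rampStep q.2) 0

lemma IsCollar.collarStep_apply (ha : IsCollar γ a) (q : Circle × ℝ) :
    collarStep a (a q) = rampStep q.2 := ha.injective.extend_apply _ _ _

lemma IsCollar.collarStep_eq_zero (ha : IsCollar γ a) {p : S}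
    (hp : p ∉ a '' (univ ×ˢ Ioo (-1) 1)) : collarStep a p = 0 := by
  by_cases h : ∃ q, a q = p
  · obtain ⟨q, rfl⟩ := h
    rw [ha.collarStep_apply]
    exact rampStep_eq_zero fun hq => hp ⟨q, ⟨mem_univ _, hq⟩, rfl⟩
  · exact Function.extend_apply' _ _ _ h

lemma isCompact_collarBand : IsCompact ((univ : Set Circle) ×ˢ Icc (-1 : ℝ) 1) :=
  isCompact_univ.prod isCompact_Icc

variable [T2Space S]

lemma IsCollar.continuousAt_collarStep (ha : IsCollar γ a) {p : S} (hp : p ∉ range γ) :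
    ContinuousAt (collarStep a) p := by
  refine continuousAt_extend_zero ha.isOpenEmbedding isCompact_collarBand (fun q hq => ?_) ?_
  · exact rampStep_eq_zero fun h => hq ⟨mem_univ _, Ioo_subset_Icc_self h⟩
  · rintro q rfl
    exact (continuousAt_rampStep fun h => hp ((ha.mem_range_iff q).2 h)).comp continuousAt_snd

lemma IsCollar.continuous_coe_collarStep (ha : IsCollar γ a) :
    Continuous fun p => (collarStep a p : AddCircle (1 : ℝ)) := by
  have : (fun p => (collarStep a p : AddCircle (1 : ℝ))) =
      Function.extend a (fun q => ((ramp q.2 : ℝ) : AddCircle (1 : ℝ))) 0 := by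
    ext p
    by_cases h : ∃ q, a q = p
    · obtain ⟨q, rfl⟩ := h
      rw [ha.collarStep_apply, ha.injective.extend_apply, coe_rampStep]
    · rw [collarStep, Function.extend_apply' _ _ _ h, Function.extend_apply' _ _ _ h]
      simp
  rw [this]
  refine continuous_iff_continuousAt.2 fun p => continuousAt_extend_zero ha.isOpenEmbedding
    isCompact_collarBand (fun q hq => ?_) fun q _ => ?_
  · rw [← coe_rampStep, rampStep_eq_zero fun h => hq ⟨mem_univ _, Ioo_subset_Icc_self h⟩]
    rfl
  · exact ((AddCircle.continuous_mk' 1).comp (continuous_ramp.comp continuous_snd)).continuousAt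

end Collar

/-! ### Smoothing an integral function with constant jumps -/

section Height

variable {S : Type v} [TopologicalSpace S]

/-- Polar coordinates: the punctured ball is the image of an interval times the unit sphere, which
is connected in dimension greater than 1. -/
lemma isPreconnected_ball_diff_center {V : Type*} [NormedAddCommGroup V] [NormedSpace ℝ V]
    (h : 1 < Module.rank ℝ V) (x : V) (r : ℝ) : IsPreconnected (Metric.ball x r \ {x}) := by
  have : Metric.ball x r \ {x} =
      (fun q : ℝ × V => x + q.1 • q.2) '' (Ioo 0 r ×ˢ Metric.sphere 0 1) := by
    ext y
    constructor
    · rintro ⟨hy, hyx⟩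
      have hn : 0 < ‖y - x‖ := norm_pos_iff.2 (sub_ne_zero.2 hyx)
      refine ⟨(‖y - x‖, ‖y - x‖⁻¹ • (y - x)), ⟨⟨hn, by simpa [dist_eq_norm] using hy⟩, ?_⟩, ?_⟩
      · simp [norm_smul, hn.ne']
      · simp [smul_smul, hn.ne']
    · rintro ⟨⟨ρ, u⟩, ⟨⟨h0, h1⟩, hu⟩, rfl⟩
      have hu' : ‖u‖ = 1 := by simpa using hu
      simp only at h0 h1
      refine ⟨by simp [dist_eq_norm, norm_smul, hu', abs_of_pos h0, h1], ?_⟩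
      have : u ≠ 0 := by rintro rfl; simp at hu'
      simp [h0.ne', this]
  rw [this]
  exact (isPreconnected_Ioo.prod (isPreconnected_sphere h 0 1)).image _ (by fun_prop)

/-- Small punctured neighbourhoods of a point of a surface can be chosen connected. -/
lemma exists_mem_nhds_isPreconnected_diff [ChartedSpace (EuclideanSpace ℝ (Fin 2)) S] {p : S}
    {U : Set S} (hU : U ∈ 𝓝 p) : ∃ W ∈ 𝓝 p, W ⊆ U ∧ IsPreconnected (W \ {p}) := by
  let e := chartAt (EuclideanSpace ℝ (Fin 2)) p
  have hp : p ∈ e.source := mem_chart_source _ p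
  have h1 : e.target ∩ e.symm ⁻¹' U ∈ 𝓝 (e p) := by
    refine inter_mem (e.open_target.mem_nhds (e.map_source hp)) ?_
    exact (e.continuousAt_symm (e.map_source hp)).preimage_mem_nhds (by rwa [e.left_inv hp])
  obtain ⟨r, hr, hB⟩ := Metric.mem_nhds_iff.1 h1
  refine ⟨e.symm '' Metric.ball (e p) r, ?_, ?_, ?_⟩
  · have := e.symm.image_mem_nhds (e.map_source hp) (Metric.ball_mem_nhds _ hr)
    rwa [e.left_inv hp] at this
  · rintro _ ⟨y, hy, rfl⟩
    exact (hB hy).2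
  · have : e.symm '' Metric.ball (e p) r \ {p} = e.symm '' (Metric.ball (e p) r \ {e p}) := by
      ext x
      constructor
      · rintro ⟨⟨y, hy, rfl⟩, hx⟩
        refine ⟨y, ⟨hy, ?_⟩, rfl⟩
        rintro rfl
        exact hx (e.left_inv hp)
      · rintro ⟨y, ⟨hy, hne⟩, rfl⟩
        refine ⟨⟨y, hy, rfl⟩, fun h => hne ?_⟩
        have h' : e.symm y = p := h
        rw [mem_singleton_iff, ← h', e.right_inv (hB hy).1]
    rw [this]
    refine (isPreconnected_ball_diff_center ?_ _ _).image _
      (e.continuousOn_symm.mono fun y hy => (hB hy.1).1)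
    rw [rank_eq_card_basis (EuclideanSpace.basisFun (Fin 2) ℝ).toBasis]
    norm_num

/-- A real function with limits along a dense set `A` off a finite set of points of a surface, which
agrees modulo `1` with a continuous circle-valued function, has limits everywhere. -/
lemma exists_tendsto_of_finite [T2Space S] [ChartedSpace (EuclideanSpace ℝ (Fin 2)) S] {A T : Set S}
    (hA : Dense A) (hT : T.Finite) (hAT : Disjoint A T) {f : S → ℝ} (hfA : ContinuousOn f A)
    {e : S → AddCircle (1 : ℝ)} (he : Continuous e) (hfe : ∀ p ∈ A, (f p : AddCircle (1 : ℝ)) = e p)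
    (hlim : ∀ p ∉ T, ∃ y, Tendsto f (𝓝[A] p) (𝓝 y)) (p : S) : ∃ y, Tendsto f (𝓝[A] p) (𝓝 y) := by
  by_cases hp : p ∈ T
  swap
  · exact hlim p hp
  have hcont : ContinuousOn (extendFrom A f) Tᶜ := continuousOn_extendFrom (fun x _ => hA x) hlim
  have hext : ∀ x ∉ T, ((extendFrom A f x : ℝ) : AddCircle (1 : ℝ)) = e x := by
    intro x hx
    have := mem_closure_iff_nhdsWithin_neBot.mp (hA x)
    have h1 : Tendsto (fun y => (f y : AddCircle (1 : ℝ))) (𝓝[A] x)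
        (𝓝 ((extendFrom A f x : ℝ) : AddCircle (1 : ℝ))) :=
      ((AddCircle.continuous_mk' 1).tendsto _).comp (tendsto_extendFrom (hlim x hx))
    refine tendsto_nhds_unique h1 ((he.continuousAt.mono_left nhdsWithin_le_nhds).congr' ?_)
    filter_upwards [self_mem_nhdsWithin] with y hy
    exact (hfe y hy).symm
  obtain ⟨r, hr⟩ := QuotientAddGroup.mk_surjective (e p)
  obtain ⟨φ, hrφ, hφ⟩ := AddCircle.isLocalHomeomorph_coe (1 : ℝ) r
  have hep : e p ∈ φ.target := by rw [← hr, hφ]; exact φ.map_source hrφ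
  have hU : e ⁻¹' φ.target ∩ (T \ {p})ᶜ ∈ 𝓝 p := by
    refine inter_mem ((φ.open_target.preimage he).mem_nhds hep) ?_
    exact (hT.subset sdiff_subset).isClosed.isOpen_compl.mem_nhds (by simp)
  obtain ⟨W, hW, hWU, hWc⟩ := exists_mem_nhds_isPreconnected_diff hU
  -- A continuous real lift of e on a whole neighbourhood of p, obtained from a local inverse of ℝ →
  -- ℝ/ℤ.
  let l : S → ℝ := fun x => φ.symm (e x)
  have hl : ContinuousOn l W := φ.continuousOn_symm.comp he.continuousOn fun x hx => (hWU hx).1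
  have hle : ∀ x ∈ W, (l x : AddCircle (1 : ℝ)) = e x := by
    intro x hx
    have := φ.right_inv (hWU hx).1
    rwa [← hφ] at this
  have hWT : ∀ x ∈ W \ {p}, x ∉ T := fun x hx h => (hWU hx.1).2 ⟨h, hx.2⟩
  have : PreconnectedSpace ↥(W \ {p}) := Subtype.preconnectedSpace hWc
  have hne : (W ∩ A).Nonempty := by
    obtain ⟨y, hyA, hyW⟩ := hA.inter_nhds_nonempty hW
    exact ⟨y, hyW, hyA⟩
  obtain ⟨y, hyW, hyA⟩ := hne
  have hAp : ∀ x ∈ A, x ≠ p := fun x hx h => disjoint_left.1 hAT hx (h ▸ hp)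
  -- On the connected set W \ {p} both l and the extension of f lift e, so they differ by a
  -- constant. As l is continuous at p, this produces the missing limit.
  have hkey : ∀ x ∈ W ∩ A, f x = l x + (f y - l y) := by
    rintro x ⟨hxW, hxA⟩
    have := AddCircle.lift_sub_eq (A := ↥(W \ {p})) (g := fun z => extendFrom A f z)
      (g' := fun z => l z)
      (continuousOn_iff_continuous_domRestrict.1 (hcont.mono hWT))
      (continuousOn_iff_continuous_domRestrict.1 (hl.mono sdiff_subset))
      (fun z => by rw [hext _ (hWT z z.2), hle _ z.2.1]) ⟨y, hyW, hAp y hyA⟩ ⟨x, hxW, hAp x hxA⟩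
    simp only [extendFrom_extends hfA x hxA, extendFrom_extends hfA y hyA] at this
    linarith
  refine ⟨l p + (f y - l y), ?_⟩
  have h2 : Tendsto (fun x => l x + (f y - l y)) (𝓝[A] p) (𝓝 (l p + (f y - l y))) :=
    (((hl.continuousAt hW).add continuousAt_const).tendsto).mono_left nhdsWithin_le_nhds
  refine h2.congr' ?_
  filter_upwards [self_mem_nhdsWithin, mem_nhdsWithin_of_mem_nhds hW] with x hxA hxW
  exact (hkey x ⟨hxW, hxA⟩).symm

end Height


/-! ### Removing constant jumps along a finite family of collared curves -/

section Height

variable {S : Type v} [TopologicalSpace S] [T2Space S] [ChartedSpace (EuclideanSpace ℝ (Fin 2)) S]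
  {ι : Type*} {γ : ι → Circle → S} {a : ι → Circle × ℝ → S}

instance : LocallyConnectedSpace Circle :=
  ChartedSpace.locallyConnectedSpace (EuclideanSpace ℝ (Fin 1)) Circle

omit [T2Space S] in
/-- Near a point on exactly one of the curves, an integral function which is constant on connected
subsets of the complement of the curves and jumps by `c` has limits after subtracting the jump. -/
lemma IsCollar.exists_tendsto_add_step {γ : Circle → S} {a : Circle × ℝ → S} (ha : IsCollar γ a)
    {O : Set S} (hO : IsClosed O) {n : S → ℤ}
    (hn : ∀ s ⊆ (range γ ∪ O)ᶜ, IsPreconnected s → ∀ p ∈ s, ∀ q ∈ s, n p = n q) {c : ℤ} {θ : Circle}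
    (hθ : γ θ ∉ O) (hc : ∀ᶠ t : ℝ in 𝓝[>] 0, n (a (θ, t)) - n (a (θ, -t)) = c) :
    ∃ y, Tendsto (fun p => (n p : ℝ) + c * collarStep a p) (𝓝[(range γ ∪ O)ᶜ] (γ θ)) (𝓝 y) := by
  have hV : a ⁻¹' Oᶜ ∈ 𝓝 (θ, (0 : ℝ)) :=
    (hO.isOpen_compl.preimage ha.isOpenEmbedding.continuous).mem_nhds (by
      rw [mem_preimage, ha.core]; exact hθ)
  rw [nhds_prod_eq, mem_prod_iff] at hV
  obtain ⟨U, hU, J, hJ, hUJ⟩ := hV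
  obtain ⟨I, hIU, hI, hθI, hIc⟩ := locallyConnectedSpace_iff_subsets_isOpen_isConnected.1
    inferInstance θ U hU
  obtain ⟨ε, hε, hεJ⟩ := Metric.mem_nhds_iff.1 hJ
  rw [Real.ball_eq_Ioo, zero_sub, zero_add] at hεJ
  -- n is constant on each half of the box I × (-ε, ε), because the image of a half is connected and
  -- misses all curves. The jump can then be read off at the single height `t₀`.
  have hconst : ∀ K ⊆ Ioo (-ε) ε, _root_.IsPreconnected K → (0 : ℝ) ∉ K → ∀ q ∈ I ×ˢ K, ∀ q' ∈ I ×ˢ K,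
      n (a q) = n (a q') := by
    intro K hK hKc h0 q hq q' hq'
    refine hn (a '' (I ×ˢ K)) ?_
      ((hIc.isPreconnected.prod hKc).image a ha.isOpenEmbedding.continuous.continuousOn)
      _ (mem_image_of_mem a hq) _ (mem_image_of_mem a hq')
    rintro _ ⟨r, hr, rfl⟩ (h | h)
    · rw [ha.mem_range_iff] at h
      exact h0 (h ▸ hr.2)
    · exact hUJ (mk_mem_prod (hIU hr.1) (hεJ (hK hr.2)) : (r.1, r.2) ∈ _) h
  have hlt : ∀ᶠ t : ℝ in 𝓝[>] 0, t < ε := mem_nhdsWithin_of_mem_nhds (Iio_mem_nhds hε)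
  obtain ⟨t₀, ⟨ht₀, ht₀ε⟩, ht₀0⟩ := ((hc.and hlt).and self_mem_nhdsWithin).exists
  have ht₀0' : 0 < t₀ := ht₀0
  have hpos : ∀ q ∈ I ×ˢ Ioo 0 ε, n (a q) = n (a (θ, -t₀)) + c := by
    intro q hq
    rw [hconst (Ioo 0 ε) (Ioo_subset_Ioo (by linarith) le_rfl) isPreconnected_Ioo (by simp) q hq
      (θ, t₀) ⟨hθI, ht₀0', ht₀ε⟩]
    omega
  have hneg : ∀ q ∈ I ×ˢ Ioo (-ε) 0, n (a q) = n (a (θ, -t₀)) := fun q hq =>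
    hconst (Ioo (-ε) 0) (Ioo_subset_Ioo le_rfl hε.le) isPreconnected_Ioo (by simp) q hq
      (θ, -t₀) ⟨hθI, by simp only; linarith, by simp only; linarith⟩
  -- Above the core, the jump c of n cancels the -c of the unit step; hence on both sides the sum is
  -- `n (a (θ, -t₀))` plus c times the continuous ramp.
  refine ⟨n (a (θ, -t₀)) + c * ramp 0, ?_⟩
  have hmap : 𝓝 (γ θ) = map a (𝓝 (θ, 0)) := by rw [← ha.core, ha.isOpenEmbedding.map_nhds_eq]
  have key : Tendsto (fun q : Circle × ℝ => (n (a q) : ℝ) + c * collarStep a (a q))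
      (𝓝[{q | q.2 ≠ 0}] (θ, 0)) (𝓝 (n (a (θ, -t₀)) + c * ramp 0)) := by
    have h1 : Tendsto (fun q : Circle × ℝ => (n (a (θ, -t₀)) : ℝ) + c * ramp q.2)
        (𝓝[{q | q.2 ≠ 0}] (θ, 0)) (𝓝 (n (a (θ, -t₀)) + c * ramp 0)) := by
      have : Continuous fun q : Circle × ℝ => (n (a (θ, -t₀)) : ℝ) + c * ramp q.2 :=
        continuous_const.add (continuous_const.mul (continuous_ramp.comp continuous_snd))
      exact (this.tendsto (θ, 0)).mono_left nhdsWithin_le_nhds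
    refine h1.congr' ?_
    have hnhd : I ×ˢ Ioo (-ε) ε ∈ 𝓝[{q : Circle × ℝ | q.2 ≠ 0}] (θ, 0) :=
      mem_nhdsWithin_of_mem_nhds
        (prod_mem_nhds (hI.mem_nhds hθI) (Ioo_mem_nhds (neg_lt_zero.2 hε) hε))
    filter_upwards [hnhd, self_mem_nhdsWithin] with q hq hq0
    rw [ha.collarStep_apply, rampStep]
    rcases lt_or_gt_of_ne hq0 with h | h
    · rw [hneg q ⟨hq.1, hq.2.1, h⟩, if_neg (not_lt.2 h.le), sub_zero]
    · rw [hpos q ⟨hq.1, h, hq.2.2⟩, if_pos h]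
      push_cast
      ring
  rw [nhdsWithin, hmap]
  intro Z hZ
  have hk := key hZ
  rw [mem_map, mem_inf_principal, mem_map]
  rw [mem_map, mem_nhdsWithin_iff_eventually] at hk
  filter_upwards [hk] with q hq hqA
  refine hq fun h0 => hqA (Or.inl ((ha.mem_range_iff q).2 h0))

variable [Fintype ι]

/-- The sum of the step functions across collars of curves, with integral weights. -/
def stepSum (a : ι → Circle × ℝ → S) (c : ι → ℤ) (p : S) : ℝ := ∑ k, c k * collarStep (a k) p

lemma continuousAt_stepSum (ha : ∀ k, IsCollar (γ k) (a k)) (c : ι → ℤ) {p : S}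
    (hp : p ∉ ⋃ k, range (γ k)) : ContinuousAt (stepSum a c) p := by
  unfold stepSum
  refine tendsto_finsetSum _ fun k _ => ?_
  exact continuousAt_const.mul ((ha k).continuousAt_collarStep fun h => hp (mem_iUnion.2 ⟨k, h⟩))

lemma continuous_coe_stepSum (ha : ∀ k, IsCollar (γ k) (a k)) (c : ι → ℤ) :
    Continuous fun p => (stepSum a c p : AddCircle (1 : ℝ)) := by
  have : (fun p => (stepSum a c p : AddCircle (1 : ℝ))) =
      fun p => ∑ k, c k • (collarStep (a k) p : AddCircle (1 : ℝ)) := by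
    ext p
    unfold stepSum
    simp only [← coe_intCast_mul]
    exact map_sum (QuotientAddGroup.mk' _) _ _
  rw [this]
  exact continuous_finsetSum _ fun k _ => ((ha k).continuous_coe_collarStep).zsmul _

lemma dense_compl_iUnion_range [CompactSpace S] (ha : ∀ k, IsCollar (γ k) (a k)) :
    Dense (⋃ k, range (γ k))ᶜ := by
  rw [compl_iUnion]
  exact dense_iInter_of_isOpen (fun k => (ha k).isClosed_range.isOpen_compl)
    fun k => (ha k).dense_compl_range

/-- An integral function off finitely many curves, constant on connected sets and with a constant
jump along each of the curves, becomes continuous after adding multiples of step functions. -/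
theorem exists_continuous_eq_add_stepSum [CompactSpace S] (ha : ∀ k, IsCollar (γ k) (a k))
    {n : S → ℤ}
    (hn : ∀ s ⊆ (⋃ k, range (γ k))ᶜ, IsPreconnected s → ∀ p ∈ s, ∀ q ∈ s, n p = n q) (c : ι → ℤ)
    (hc : ∀ k θ, (∀ l ≠ k, γ k θ ∉ range (γ l)) →
      ∀ᶠ t : ℝ in 𝓝[>] 0, n (a k (θ, t)) - n (a k (θ, -t)) = c k)
    (hfin : {p | ∃ k l, k ≠ l ∧ p ∈ range (γ k) ∧ p ∈ range (γ l)}.Finite) :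
    ∃ h : C(S, ℝ), (∀ p ∉ ⋃ k, range (γ k), h p = n p + stepSum a c p) ∧
      ∀ p, (h p : AddCircle (1 : ℝ)) = stepSum a c p := by
  have : LocallyConnectedSpace S :=
    ChartedSpace.locallyConnectedSpace (EuclideanSpace ℝ (Fin 2)) S
  set A : Set S := (⋃ k, range (γ k))ᶜ with hA
  set T : Set S := {p | ∃ k l, k ≠ l ∧ p ∈ range (γ k) ∧ p ∈ range (γ l)} with hT
  have hAo : IsOpen A := (isClosed_iUnion_of_finite fun k => (ha k).isClosed_range).isOpen_compl
  have hAd : Dense A := dense_compl_iUnion_range ha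
  let f : S → ℝ := fun p => n p + stepSum a c p
  have hfe : ∀ p, (f p : AddCircle (1 : ℝ)) = stepSum a c p := by
    intro p
    simp only [f]
    rw [AddCircle.coe_add, AddCircle.coe_intCast, zero_add]
  have hfA : ∀ p ∈ A, ContinuousAt f p := by
    intro p hp
    refine ContinuousAt.add ?_ (continuousAt_stepSum ha c hp)
    refine (continuousAt_const (y := (n p : ℝ))).congr ?_
    filter_upwards [(hAo.connectedComponentIn (x := p)).mem_nhds (mem_connectedComponentIn hp)]
      with q hq
    rw [hn _ (connectedComponentIn_subset A p) isPreconnected_connectedComponentIn p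
      (mem_connectedComponentIn hp) q hq]
  have hlim : ∀ p ∉ T, ∃ y, Tendsto f (𝓝[A] p) (𝓝 y) := by
    intro p hp
    by_cases hpA : p ∈ A
    · exact ⟨f p, (hfA p hpA).mono_left nhdsWithin_le_nhds⟩
    obtain ⟨k, θ, rfl⟩ : ∃ k, p ∈ range (γ k) := by simpa [hA] using hpA
    have hk : ∀ l ≠ k, γ k θ ∉ range (γ l) := fun l hl h => hp ⟨k, l, hl.symm, ⟨θ, rfl⟩, h⟩
    classical
    let O : Set S := ⋃ l ∈ {l | l ≠ k}, range (γ l)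
    have hAO : A = (range (γ k) ∪ O)ᶜ := by
      rw [hA]
      congr 1
      ext x
      simp only [mem_iUnion, mem_union, O, mem_ofPred_eq, exists_prop]
      constructor
      · rintro ⟨l, hl⟩
        by_cases hlk : l = k
        · exact Or.inl (hlk ▸ hl)
        · exact Or.inr ⟨l, hlk, hl⟩
      · rintro (h | ⟨l, -, h⟩)
        exacts [⟨k, h⟩, ⟨l, h⟩]
    have hOc : IsClosed O := (Set.toFinite _).isClosed_biUnion fun l _ => (ha l).isClosed_range
    have hO : γ k θ ∉ O := by
      simp only [O, mem_iUnion, not_exists]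
      exact fun l hl => hk l hl
    obtain ⟨y, hy⟩ := (ha k).exists_tendsto_add_step hOc (hAO ▸ hn) hO (hc k θ hk)
    rw [← hAO] at hy
    -- Collars of different curves may overlap here; only the discontinuity on the core matters, and
    -- the point is off all other cores.
    have hrest : ContinuousAt (fun p => ∑ l ∈ Finset.univ.erase k, (c l : ℝ) * collarStep (a l) p)
        (γ k θ) := by
      refine tendsto_finsetSum _ fun l hl => ?_
      exact continuousAt_const.mul ((ha l).continuousAt_collarStep (hk l (Finset.ne_of_mem_erase hl)))
    refine ⟨_, (hy.add (hrest.tendsto.mono_left nhdsWithin_le_nhds)).congr fun x => ?_⟩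
    simp only [f, stepSum]
    rw [← Finset.add_sum_erase _ _ (Finset.mem_univ k), add_assoc]
  have hlim' : ∀ p, ∃ y, Tendsto f (𝓝[A] p) (𝓝 y) :=
    exists_tendsto_of_finite hAd hfin
      (disjoint_left.2 fun p hp ⟨k, _, _, hk, _⟩ => hp (mem_iUnion.2 ⟨k, hk⟩))
      (fun p hp => (hfA p hp).continuousWithinAt) (continuous_coe_stepSum ha c)
      (fun p _ => hfe p) hlim
  refine ⟨⟨extendFrom A f, continuous_extendFrom hAd hlim'⟩, fun p hp => ?_, fun p => ?_⟩
  · exact extendFrom_extends (fun p hp => (hfA p hp).continuousWithinAt) p hp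
  · have := Continuous.ext_on hAd
      (f := fun p => ((extendFrom A f p : ℝ) : AddCircle (1 : ℝ)))
      ((AddCircle.continuous_mk' 1).comp (continuous_extendFrom hAd hlim'))
      (continuous_coe_stepSum ha c) fun q hq => by
        simp only
        rw [extendFrom_extends (fun p hp => (hfA p hp).continuousWithinAt) q hq, hfe]
    exact congrFun this p

end Height


/-! ### Circle-valued functions on handlebodies -/

section Filling

variable {S : Type v} [TopologicalSpace S] [ChartedSpace (EuclideanSpace ℝ (Fin 2)) S]
  {M : Type u} [TopologicalSpace M]

/-- Attaching annuli are disjoint, so only one summand survives. The value does not depend on θ,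
hence extends over the disk factor of the handle. -/
lemma stepSum_of_mem_annulus {d : ℕ} {γ : Fin d → Circle → S} {a : Fin d → Circle × ℝ → S}
    (ha : ∀ i, IsCollar (γ i) (a i))
    (hdisj : ∀ i i', i ≠ i' →
      Disjoint (a i '' (univ ×ˢ Icc (-1) 1)) (a i' '' (univ ×ˢ Icc (-1) 1)))
    (c : Fin d → ℤ) (i : Fin d) (θ : Circle) {t : ℝ} (ht : t ∈ Icc (-1 : ℝ) 1) :
    (stepSum a c (a i (θ, t)) : AddCircle (1 : ℝ)) = ((c i * ramp t : ℝ) : AddCircle (1 : ℝ)) := by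
  have : stepSum a c (a i (θ, t)) = c i * rampStep t := by
    unfold stepSum
    rw [Finset.sum_eq_single i, (ha i).collarStep_apply]
    · intro l _ hl
      rw [(ha l).collarStep_eq_zero, mul_zero]
      rintro ⟨q, hq, hqe⟩
      exact disjoint_left.1 (hdisj l i hl)
        ⟨q, ⟨hq.1, Ioo_subset_Icc_self hq.2⟩, hqe⟩ ⟨(θ, t), ⟨mem_univ _, ht⟩, rfl⟩
    · simp
  rw [this, coe_intCast_mul, coe_intCast_mul, coe_rampStep]

lemma stepSum_of_notMem_annulus {d : ℕ} {γ : Fin d → Circle → S} {a : Fin d → Circle × ℝ → S}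
    (ha : ∀ i, IsCollar (γ i) (a i)) (c : Fin d → ℤ) {p : S}
    (hp : p ∉ ⋃ i, a i '' (univ ×ˢ Ioo (-1) 1)) : stepSum a c p = 0 := by
  unfold stepSum
  refine Finset.sum_eq_zero fun i _ => ?_
  rw [(ha i).collarStep_eq_zero fun h => hp (mem_iUnion.2 ⟨i, h⟩), mul_zero]

/-- The disjoint union of the collar, the 2-handles and the 3-balls of a handle filling. -/
abbrev FillingPieces (S : Type v) (d k : ℕ) : Type v :=
  (S × Icc (-1 : ℝ) 0) ⊕ (Fin d × Metric.closedBall (0 : ℂ) 1 × Icc (-1 : ℝ) 1) ⊕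
    (Fin k × Metric.closedBall (0 : EuclideanSpace ℝ (Fin 3)) 1)

instance [CompactSpace S] (d k : ℕ) : CompactSpace (FillingPieces S d k) := by
  have := isCompact_iff_compactSpace.1 (isCompact_closedBall (0 : ℂ) 1)
  have := isCompact_iff_compactSpace.1 (isCompact_closedBall (0 : EuclideanSpace ℝ (Fin 3)) 1)
  infer_instance

variable {C : S × ℝ → M} {d k : ℕ} {γ : Fin d → Circle → S}

namespace HandleFilling

variable (F : HandleFilling C γ k)

/-- The map from the pieces of a handle filling to the manifold. -/
def piecesMap : FillingPieces S d k → M :=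
  Sum.elim (fun q => C (q.1, q.2)) (Sum.elim (fun q => F.handle q.1 (q.2.1, q.2.2))
    (fun q => F.cap q.1 q.2))

lemma continuous_piecesMap (hC : Continuous C) : Continuous F.piecesMap := by
  refine Continuous.sumElim (by fun_prop) (Continuous.sumElim ?_ ?_)
  · refine continuous_prod_of_discrete_left.2 fun i => ?_
    exact (F.handle_continuous i).comp_continuous (by fun_prop) fun q => ⟨q.1.2, q.2.2⟩
  · refine continuous_prod_of_discrete_left.2 fun i => ?_
    exact (F.cap_continuous i).comp_continuous (by fun_prop) fun q => q.2

lemma range_piecesMap : range F.piecesMap = F.carrier := by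
  unfold piecesMap carrier
  rw [Sum.elim_range, Sum.elim_range, union_assoc]
  congr 1
  · ext x
    constructor
    · rintro ⟨q, rfl⟩
      exact ⟨_, ⟨mem_univ _, q.2.2⟩, rfl⟩
    · rintro ⟨q, hq, rfl⟩
      exact ⟨(q.1, ⟨q.2, hq.2⟩), rfl⟩
  congr 1
  · ext x
    simp only [mem_iUnion]
    constructor
    · rintro ⟨q, rfl⟩
      exact ⟨q.1, _, ⟨q.2.1.2, q.2.2.2⟩, rfl⟩
    · rintro ⟨i, q, hq, rfl⟩
      exact ⟨(i, ⟨q.1, hq.1⟩, ⟨q.2, hq.2⟩), rfl⟩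
  · ext x
    simp only [mem_iUnion]
    constructor
    · rintro ⟨q, rfl⟩
      exact ⟨q.1, _, q.2.2, rfl⟩
    · rintro ⟨l, q, hq, rfl⟩
      exact ⟨(l, ⟨q, hq⟩), rfl⟩

/-- A circle-valued function on the pieces of a handle filling: prescribed on the collar, winding
`c i` times along the core direction of the `i`-th handle, and zero on the balls. -/
def piecesFun (K : S × ℝ → AddCircle (1 : ℝ)) (c : Fin d → ℤ) :
    FillingPieces S d k → AddCircle (1 : ℝ) :=
  Sum.elim (fun q => K (q.1, q.2)) (Sum.elim
    (fun q => ((c q.1 * ramp q.2.2 : ℝ) : AddCircle (1 : ℝ))) (fun _ => 0))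

omit [ChartedSpace (EuclideanSpace ℝ (Fin 2)) S] in
lemma continuous_piecesFun {K : S × ℝ → AddCircle (1 : ℝ)} (hK : Continuous K) (c : Fin d → ℤ) :
    Continuous (piecesFun (k := k) K c) := by
  refine Continuous.sumElim (by fun_prop) (Continuous.sumElim ?_ continuous_const)
  refine (AddCircle.continuous_mk' 1).comp (Continuous.mul ?_ ?_)
  · exact (continuous_of_discreteTopology (f := fun i => (c i : ℝ))).comp continuous_fst
  · exact continuous_ramp.comp (by fun_prop)

variable {F} {K : S × ℝ → AddCircle (1 : ℝ)} {c : Fin d → ℤ}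

/-- The open part of a handle misses the collar, so a common point lies on the attaching annulus,
where both prescriptions are the ramp. -/
lemma piecesFun_collar_handle (hC : Function.Injective C)
    (hK : ∀ p, K (p, -1) = stepSum F.annulus c p) (q q') :
    F.piecesMap (Sum.inl q) = F.piecesMap (Sum.inr (Sum.inl q')) →
      piecesFun (k := k) K c (Sum.inl q) = piecesFun (k := k) K c (Sum.inr (Sum.inl q')) := by
  obtain ⟨p, s⟩ := q
  obtain ⟨i, z, t⟩ := q'
  intro h
  change C (p, s) = F.handle i (z, t) at h
  change K (p, s) = ((c i * ramp t : ℝ) : AddCircle (1 : ℝ))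
  have hz : ‖(z : ℂ)‖ = 1 := by
    refine le_antisymm (mem_closedBall_zero_iff.1 z.2) (not_lt.1 fun hlt => ?_)
    exact disjoint_left.1 (F.handle_disjoint_collar i)
      ⟨(z, t), ⟨mem_ball_zero_iff.2 hlt, t.2⟩, rfl⟩ ⟨(p, s), ⟨mem_univ _, s.2⟩, h⟩
  let θ : Circle := ⟨z, mem_sphere_zero_iff_norm.2 hz⟩
  have h' := F.handle_attach i θ t t.2
  change F.handle i (z, t) = _ at h'
  rw [h'] at h
  rw [hC h, hK, stepSum_of_mem_annulus F.annulus_collar F.annulus_disjoint c i θ t.2]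

/-- Descent of the piecewise function to the handlebody. The balls cause no conflict: they meet the
other pieces only where the function is 0 mod 1. -/
lemma piecesFun_compatible (hC : Function.Injective C)
    (hK : ∀ p, K (p, -1) = stepSum F.annulus c p) {w w'} (h : F.piecesMap w = F.piecesMap w') :
    piecesFun (k := k) K c w = piecesFun (k := k) K c w' := by
  have hhh : ∀ q q', F.piecesMap (Sum.inr (Sum.inl q)) = F.piecesMap (Sum.inr (Sum.inl q')) →
      q = q' := by
    rintro ⟨i, z, t⟩ ⟨i', z', t'⟩ h
    change F.handle i (z, t) = F.handle i' (z', t') at h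
    by_cases hi : i = i'
    · subst hi
      have := F.handle_injective i ⟨z.2, t.2⟩ ⟨z'.2, t'.2⟩ h
      simp only [Prod.mk.injEq] at this
      rw [Subtype.ext this.1, Subtype.ext this.2]
    · exact absurd ⟨_, ⟨z'.2, t'.2⟩, h.symm⟩
        (disjoint_left.1 (F.handle_disjoint i i' hi) ⟨(z, t), ⟨z.2, t.2⟩, rfl⟩)
  have hcc : ∀ q q', F.piecesMap (Sum.inl q) = F.piecesMap (Sum.inl q') → q = q' := by
    rintro ⟨p, s⟩ ⟨p', s'⟩ h
    have := hC (show C (p, s) = C (p', s') from h)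
    simp only [Prod.mk.injEq] at this
    rw [this.1, Subtype.ext this.2]
  -- A ball point shared with the collar or a handle is on the bounding sphere, hence at level -1
  -- off the open annuli or on an end disk of a handle.
  have hattach : ∀ l s x, F.piecesMap (Sum.inr (Sum.inr (l, s))) = x →
      x ∈ C '' (univ ×ˢ Icc (-1) 0) ∪ (⋃ i, F.handle i '' (Metric.closedBall 0 1 ×ˢ Icc (-1) 1)) →
      (∃ p ∉ ⋃ i, F.annulus i '' (univ ×ˢ Ioo (-1) 1), F.piecesMap (Sum.inl (p, ⟨-1, by simp⟩)) = x)
        ∨ ∃ i z, ∃ t : Icc (-1 : ℝ) 1, (t.1 = -1 ∨ t.1 = 1) ∧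
          F.piecesMap (Sum.inr (Sum.inl (i, z, t))) = x := by
    rintro l s x rfl hx
    have hs : ‖(s : EuclideanSpace ℝ (Fin 3))‖ = 1 := by
      refine le_antisymm (mem_closedBall_zero_iff.1 s.2) (not_lt.1 fun hlt => ?_)
      exact disjoint_left.1 (F.cap_interior l) ⟨s, mem_ball_zero_iff.2 hlt, rfl⟩ hx
    have hm : F.piecesMap (Sum.inr (Sum.inr (l, s))) ∈ ⋃ l, F.cap l '' Metric.sphere 0 1 :=
      mem_iUnion.2 ⟨l, s, mem_sphere_zero_iff_norm.2 hs, rfl⟩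
    rw [F.cap_attach] at hm
    rcases hm with ⟨⟨p, t⟩, ⟨hp, rfl⟩, hpx⟩ | hm
    · exact Or.inl ⟨p, hp, hpx⟩
    · obtain ⟨i, ⟨z, t⟩, ⟨hz, ht⟩, hx⟩ := mem_iUnion.1 hm
      have ht' : t = -1 ∨ t = 1 := ht
      have ht'' : t ∈ Icc (-1 : ℝ) 1 := by rcases ht' with rfl | rfl <;> simp
      exact Or.inr ⟨i, ⟨z, hz⟩, ⟨t, ht''⟩, ht', hx⟩
  have hch := piecesFun_collar_handle (k := k) (F := F) hC hK
  have hzero : ∀ p ∉ ⋃ i, F.annulus i '' (univ ×ˢ Ioo (-1) 1),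
      piecesFun (k := k) K c (Sum.inl (p, ⟨-1, by simp⟩)) = 0 := by
    intro p hp
    change K (p, -1) = 0
    rw [hK, stepSum_of_notMem_annulus F.annulus_collar c hp]
    simp
  -- On the end disks the ramp is 0 or 1, so its multiple by `c i` is an integer.
  have hzero' : ∀ i z, ∀ t : Icc (-1 : ℝ) 1, (t.1 = -1 ∨ t.1 = 1) →
      piecesFun (k := k) K c (Sum.inr (Sum.inl (i, z, t))) = 0 := by
    intro i z t ht
    change ((c i * ramp t : ℝ) : AddCircle (1 : ℝ)) = 0
    rw [coe_intCast_mul]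
    rcases ht with h | h <;> rw [h]
    · rw [ramp_of_le le_rfl]; simp
    · rw [ramp_of_ge le_rfl, AddCircle.coe_period, smul_zero]
  have hcap : ∀ q l s, F.piecesMap (Sum.inl q) = F.piecesMap (Sum.inr (Sum.inr (l, s))) →
      piecesFun (k := k) K c (Sum.inl q) = 0 := by
    intro q l s h
    rcases hattach l s _ h.symm (Or.inl ⟨_, ⟨mem_univ _, q.2.2⟩, rfl⟩) with
      ⟨p, hp, hx⟩ | ⟨i, z, t, ht, hx⟩
    · rw [hcc _ _ hx.symm, hzero p hp]
    · rw [hch _ _ hx.symm, hzero' i z t ht]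
  have hcap' : ∀ q l s, F.piecesMap (Sum.inr (Sum.inl q)) = F.piecesMap (Sum.inr (Sum.inr (l, s))) →
      piecesFun (k := k) K c (Sum.inr (Sum.inl q)) = 0 := by
    intro q l s h
    rcases hattach l s _ h.symm
      (Or.inr (mem_iUnion.2 ⟨q.1, _, ⟨q.2.1.2, q.2.2.2⟩, rfl⟩)) with
      ⟨p, hp, hx⟩ | ⟨i, z, t, ht, hx⟩
    · rw [← hch _ _ hx, hzero p hp]
    · rw [hhh _ _ hx.symm, hzero' i z t ht]
  rcases w with q | q | ⟨l, s⟩ <;> rcases w' with q' | q' | ⟨l', s'⟩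
  · rw [hcc _ _ h]
  · exact hch _ _ h
  · exact hcap _ _ _ h
  · exact (hch _ _ h.symm).symm
  · rw [hhh _ _ h]
  · exact hcap' _ _ _ h
  · exact (hcap _ _ _ h.symm).symm
  · exact (hcap' _ _ _ h.symm).symm
  · rfl

end HandleFilling

/-- Circle-valued functions on the collars of two handle fillings that cover a space glue to a
circle-valued function, if they are step functions on the attaching levels. -/
theorem exists_circleMap_of_fillings [CompactSpace S] [T2Space M] {C : S × ℝ → M}
    (hC : Continuous C) (hCi : Function.Injective C)
    {d₁ d₂ k₁ k₂ : ℕ} {γ₁ : Fin d₁ → Circle → S} {γ₂ : Fin d₂ → Circle → S}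
    (F₁ : HandleFilling C γ₁ k₁) (F₂ : HandleFilling (fun q => C (q.1, -q.2)) γ₂ k₂)
    (hcover : F₁.carrier ∪ F₂.carrier = univ)
    (hinter : F₁.carrier ∩ F₂.carrier = C '' (univ ×ˢ {0})) (c₁ : Fin d₁ → ℤ) (c₂ : Fin d₂ → ℤ)
    {K₁ K₂ : S × ℝ → AddCircle (1 : ℝ)} (hK₁ : Continuous K₁) (hK₂ : Continuous K₂)
    (h₁ : ∀ p, K₁ (p, -1) = stepSum F₁.annulus c₁ p)
    (h₂ : ∀ p, K₂ (p, -1) = stepSum F₂.annulus c₂ p) (h₀ : ∀ p, K₁ (p, 0) = K₂ (p, 0)) :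
    ∃ Φ : C(M, AddCircle (1 : ℝ)), ∀ p, ∀ t ∈ Icc (-1 : ℝ) 0,
      Φ (C (p, t)) = K₁ (p, t) ∧ Φ (C (p, -t)) = K₂ (p, t) := by
  have hC' : Continuous fun q : S × ℝ => C (q.1, -q.2) := by fun_prop
  have hCi' : Function.Injective fun q : S × ℝ => C (q.1, -q.2) := by
    intro q q' h
    have := hCi h
    simp only [Prod.mk.injEq, neg_inj] at this
    exact Prod.ext this.1 this.2
  let f : FillingPieces S d₁ k₁ ⊕ FillingPieces S d₂ k₂ → M := Sum.elim F₁.piecesMap F₂.piecesMap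
  let w : FillingPieces S d₁ k₁ ⊕ FillingPieces S d₂ k₂ → AddCircle (1 : ℝ) :=
    Sum.elim (HandleFilling.piecesFun K₁ c₁) (HandleFilling.piecesFun K₂ c₂)
  have hf : Continuous f := (F₁.continuous_piecesMap hC).sumElim (F₂.continuous_piecesMap hC')
  have hw : Continuous w := (HandleFilling.continuous_piecesFun hK₁ c₁).sumElim
    (HandleFilling.continuous_piecesFun hK₂ c₂)
  -- The handlebodies meet only in S × {0}; both values are moved to that level inside their own
  -- handlebody and compared there by `h₀`.
  have hcross : ∀ x y, F₁.piecesMap x = F₂.piecesMap y →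
      HandleFilling.piecesFun (k := k₁) K₁ c₁ x = HandleFilling.piecesFun (k := k₂) K₂ c₂ y := by
    intro x y h
    have hx : F₁.piecesMap x ∈ F₁.carrier ∩ F₂.carrier :=
      ⟨F₁.range_piecesMap ▸ mem_range_self x, h ▸ F₂.range_piecesMap ▸ mem_range_self y⟩
    rw [hinter] at hx
    obtain ⟨⟨p, t⟩, ⟨-, ht⟩, hp⟩ := hx
    obtain rfl : t = 0 := ht
    have e1 := HandleFilling.piecesFun_compatible (c := c₁) hCi h₁ (w := x)
      (w' := Sum.inl (p, ⟨0, by simp⟩)) hp.symm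
    have e2 := HandleFilling.piecesFun_compatible (c := c₂) hCi' h₂ (w := y)
      (w' := Sum.inl (p, ⟨0, by simp⟩)) (by
        rw [← h, ← hp]
        change C (p, 0) = C (p, -0)
        rw [neg_zero])
    rw [e1, e2]
    exact h₀ p
  have hcompat : ∀ x y, f x = f y → w x = w y := by
    rintro (x | x) (y | y) h
    · exact HandleFilling.piecesFun_compatible (c := c₁) hCi h₁ h
    · exact hcross x y h
    · exact (hcross y x h.symm).symm
    · exact HandleFilling.piecesFun_compatible (c := c₂) hCi' h₂ h
  have hsurj : Function.Surjective f := by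
    rw [← range_eq_univ, Sum.elim_range, F₁.range_piecesMap, F₂.range_piecesMap, hcover]
  -- A continuous surjection from a compact space onto a Hausdorff one is a quotient map, so a
  -- compatible function on the pieces descends continuously.
  have hq : IsQuotientMap f := hf.isClosedMap.isQuotientMap hf hsurj
  have hq' : IsQuotientMap (⟨f, hf⟩ : C(_, M)) := hq
  let Φ : C(M, AddCircle (1 : ℝ)) := hq'.lift ⟨w, hw⟩ fun x y h => hcompat x y h
  have hΦ : ∀ x, Φ (f x) = w x := fun x =>
    congrArg (fun g : C(_, AddCircle (1 : ℝ)) => g x) (hq'.lift_comp ⟨w, hw⟩ hcompat)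
  exact ⟨Φ, fun p t ht => ⟨hΦ (Sum.inl (Sum.inl (p, ⟨t, ht⟩))),
    hΦ (Sum.inr (Sum.inl (p, ⟨t, ht⟩)))⟩⟩

end Filling


/-! ### Periodic domains of Heegaard diagrams -/

section Periodic

variable {S : Type v} [TopologicalSpace S] [T2Space S] [CompactSpace S]
  [ChartedSpace (EuclideanSpace ℝ (Fin 2)) S] [IsManifold (𝓡 2) ∞ S]
  {M : Type u} [TopologicalSpace M] [T2Space M] [ChartedSpace (EuclideanSpace ℝ (Fin 3)) M]
  [IsManifold (𝓡 3) ∞ M]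

omit [T2Space S] [CompactSpace S] in
lemma PointedDiagram.mult_eq_of_isPreconnected {d₁ d₂ m : ℕ} (D : PointedDiagram S d₁ d₂ m)
    (P : D.Domain) {s : Set S} (hs : s ⊆ D.complement) (hc : IsPreconnected s) {p q : S}
    (hp : p ∈ s) (hq : q ∈ s) : D.mult P p = D.mult P q := by
  unfold PointedDiagram.mult
  rw [dif_pos (hs hp), dif_pos (hs hq)]
  congr 1
  rw [ConnectedComponents.coe_eq_coe']
  have hpre : IsPreconnected ((↑) ⁻¹' s : Set D.complement) := by
    rw [← IsInducing.subtypeVal.isPreconnected_image, Subtype.image_preimage_coe,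
      inter_eq_self_of_subset_right hs]
    exact hc
  exact hpre.subset_connectedComponent hq hp

/-- A continuous real function with integral values on a set, constant on connected subsets. -/
lemma eq_of_coe_eq_zero {X : Type*} [TopologicalSpace X] {f : X → ℝ} {s : Set X}
    (hc : _root_.IsPreconnected s) (hf : ContinuousOn f s)
    (h0 : ∀ x ∈ s, (f x : AddCircle (1 : ℝ)) = 0) {p q : X} (hp : p ∈ s) (hq : q ∈ s) :
    f p = f q := by
  have : PreconnectedSpace s := Subtype.preconnectedSpace hc
  have := AddCircle.lift_sub_eq (A := s) (g := fun x => f x) (g' := fun _ => 0)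
    (continuousOn_iff_continuous_domRestrict.1 hf) continuous_const
    (fun x => by rw [h0 x x.2]; simp) ⟨p, hp⟩ ⟨q, hq⟩
  simp only at this
  linarith

/-- If `H₁(M) = 0`, the multiplicities of a periodic domain are the differences of a function which
is constant on the components of the complement of the `α`-curves and one which is constant on the
components of the complement of the `β`-curves. -/
theorem HeegaardPresentation.exists_mult_eq_sub [ConnectedSpace S] (hM : Limits.IsZero (H1 M))
    {d₁ d₂ m : ℕ} {D : PointedDiagram S d₁ d₂ m} {oM : ManifoldOrientation 3 M} {V₁ V₂ E : Type}
    [Fintype V₁] [Fintype V₂] {G : SpatialGraph V₁ V₂ E M} {g : ℕ}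
    (H : HeegaardPresentation D oM G g) {P : D.Domain} (hP : D.IsPeriodic P) :
    ∃ fα fβ : S → ℝ,
      (∀ s ⊆ (curveUnion D.α)ᶜ, IsPreconnected s → ∀ p ∈ s, ∀ q ∈ s, fα p = fα q) ∧
      (∀ s ⊆ (curveUnion D.β)ᶜ, IsPreconnected s → ∀ p ∈ s, ∀ q ∈ s, fβ p = fβ q) ∧
      ∀ p ∈ D.complement, (D.mult P p : ℝ) = fα p - fβ p := by
  have haα := H.Uα.annulus_collar
  have haβ := H.Uβ.annulus_collar
  choose cα hcα using fun i => hP.along_α i _ (haα i)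
  choose cβ hcβ using fun j => hP.along_β j _ (haβ j)
  let γ : Fin d₁ ⊕ Fin d₂ → Circle → S := Sum.elim D.α D.β
  let a : Fin d₁ ⊕ Fin d₂ → Circle × ℝ → S := Sum.elim H.Uα.annulus H.Uβ.annulus
  have ha : ∀ k, IsCollar (γ k) (a k) := by rintro (i | j); exacts [haα i, haβ j]
  have hU : (⋃ k, range (γ k)) = curveUnion D.α ∪ curveUnion D.β := iUnion_sum
  have hA : (⋃ k, range (γ k))ᶜ = D.complement := by rw [hU]; rfl
  have hsum : ∀ p, stepSum a (Sum.elim cα cβ) p =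
      stepSum H.Uα.annulus cα p + stepSum H.Uβ.annulus cβ p := by
    intro p
    simp [stepSum, Fintype.sum_sum_type, a]
  obtain ⟨h, hh, hhe⟩ := exists_continuous_eq_add_stepSum ha (n := D.mult P)
    (fun s hs hc p hp q hq => D.mult_eq_of_isPreconnected P (hA ▸ hs) hc hp hq) (Sum.elim cα cβ)
    (by
      rintro (i | j) θ hθ
      · refine hcα i θ fun hmem => ?_
        obtain ⟨j, hj⟩ := mem_iUnion.1 hmem
        exact hθ (Sum.inr j) (by simp) hj
      · refine hcβ j θ fun hmem => ?_
        obtain ⟨i, hi⟩ := mem_iUnion.1 hmem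
        exact hθ (Sum.inl i) (by simp) hi)
    (by
      refine D.finite_inter.subset ?_
      rintro p ⟨k | k, l | l, hkl, hk, hl⟩
      · exact absurd hl (disjoint_left.1 (D.α_disjoint k l fun h => hkl (h ▸ rfl)) hk)
      · exact ⟨mem_iUnion.2 ⟨k, hk⟩, mem_iUnion.2 ⟨l, hl⟩⟩
      · exact ⟨mem_iUnion.2 ⟨l, hl⟩, mem_iUnion.2 ⟨k, hk⟩⟩
      · exact absurd hl (disjoint_left.1 (D.β_disjoint k l fun h => hkl (h ▸ rfl)) hk))
  have hneg : ∀ p, stepSum H.Uβ.annulus (-cβ) p = -stepSum H.Uβ.annulus cβ p := by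
    intro p
    simp [stepSum]
  have hC : Continuous H.C := H.C_localDiffeo.isLocalHomeomorph.continuous
  have hEα := continuous_coe_stepSum haα cα
  have hEβ := continuous_coe_stepSum haβ (-cβ)
  -- The factor t + 1 vanishes at the attaching level -1 and equals 1 at level 0, where eα - h ≡
  -- -eβ; this forces the weights `-cβ` on the β-side.
  obtain ⟨Φ, hΦ⟩ := exists_circleMap_of_fillings hC H.C_injective H.Uα H.Uβ H.cover H.inter cα (-cβ)
    (K₁ := fun q => (stepSum H.Uα.annulus cα q.1 : AddCircle (1 : ℝ)) -
      (((q.2 + 1) * h q.1 : ℝ) : AddCircle (1 : ℝ)))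
    (K₂ := fun q => (stepSum H.Uβ.annulus (-cβ) q.1 : AddCircle (1 : ℝ)))
    ((hEα.comp continuous_fst).sub ((AddCircle.continuous_mk' 1).comp (by fun_prop)))
    (hEβ.comp continuous_fst) (fun p => by simp) (fun p => rfl)
    (fun p => by
      simp only [zero_add, one_mul, hhe, hsum, hneg, AddCircle.coe_add, AddCircle.coe_neg]
      abel)
  have : LocallyPathConnectedSpace S :=
    ChartedSpace.locallyPathConnectedSpace (EuclideanSpace ℝ (Fin 2)) S
  have : PathConnectedSpace S := pathConnectedSpace_iff_connectedSpace.2 inferInstance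
  obtain ⟨L, hL⟩ := exists_lift_of_isZero_H1 Φ hM ⟨H.C, hC⟩
  have hL' : ∀ p t, (L (p, t) : AddCircle (1 : ℝ)) = Φ (H.C (p, t)) := fun p t => hL (p, t)
  have hα : ∀ p, (L (p, -1) : AddCircle (1 : ℝ)) = stepSum H.Uα.annulus cα p := by
    intro p
    rw [hL', (hΦ p (-1) (by simp)).1]
    simp
  have hβ : ∀ p, ∀ t ∈ Icc (-1 : ℝ) 0,
      (L (p, -t) : AddCircle (1 : ℝ)) = -(stepSum H.Uβ.annulus cβ p : AddCircle (1 : ℝ)) := by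
    intro p t ht
    rw [hL', (hΦ p t ht).2, hneg, AddCircle.coe_neg]
  -- On the vertical segment over p, L + (t + 1)h is constant for t in [-1, 0] and L is constant for
  -- t in [0, 1], since each is constant mod 1.
  have hLh : ∀ p, h p = L (p, -1) - L (p, 1) := by
    intro p
    have e1 := eq_of_coe_eq_zero (f := fun t => L (p, t) + (t + 1) * h p - stepSum H.Uα.annulus cα p)
      isPreconnected_Icc (Continuous.continuousOn (by fun_prop)) (fun t (ht : t ∈ Icc (-1 : ℝ) 0) => by
        simp only [AddCircle.coe_sub, AddCircle.coe_add, hL', (hΦ p t ht).1]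
        abel) (p := -1) (q := 0) (by simp) (by simp)
    have e2 := eq_of_coe_eq_zero (f := fun t => L (p, -t) + stepSum H.Uβ.annulus cβ p)
      isPreconnected_Icc (Continuous.continuousOn (by fun_prop)) (fun t (ht : t ∈ Icc (-1 : ℝ) 0) => by
        rw [AddCircle.coe_add, hβ p t ht, neg_add_cancel]) (p := -1) (q := 0) (by simp) (by simp)
    simp only [neg_neg, neg_zero] at e1 e2
    linarith
  refine ⟨fun p => L (p, -1) - stepSum H.Uα.annulus cα p,
    fun p => L (p, 1) + stepSum H.Uβ.annulus cβ p, fun s hs hc p hp q hq => ?_,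
    fun s hs hc p hp q hq => ?_, fun p hp => ?_⟩
  · refine eq_of_coe_eq_zero (f := fun p => L (p, -1) - stepSum H.Uα.annulus cα p) hc
      (fun x hx => ?_) (fun x _ => ?_) hp hq
    · exact ContinuousAt.continuousWithinAt
        (ContinuousAt.sub (by fun_prop) (continuousAt_stepSum haα cα (hs hx)))
    · rw [AddCircle.coe_sub, hα, sub_self]
  · refine eq_of_coe_eq_zero (f := fun p => L (p, 1) + stepSum H.Uβ.annulus cβ p) hc
      (fun x hx => ?_) (fun x _ => ?_) hp hq
    · exact ContinuousAt.continuousWithinAt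
        (ContinuousAt.add (by fun_prop) (continuousAt_stepSum haβ cβ (hs hx)))
    · have := hβ x (-1) (by simp)
      rw [neg_neg] at this
      rw [AddCircle.coe_add, this, neg_add_cancel]
  · have h1 := hh p (by rw [← mem_compl_iff, hA]; exact hp)
    have h2 := hLh p
    have h3 := hsum p
    simp only
    linarith

/-- Equality of labels across edges propagates along a walk from v to w. -/
lemma BipartiteGraph.IsConnected.eq_of_edges {V₁ V₂ E : Type} {G : BipartiteGraph V₁ V₂ E}
    (hG : G.IsConnected) {X : Type*} {φ₁ : V₁ → X} {φ₂ : V₂ → X}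
    (h : ∀ e, φ₁ (G.end₁ e) = φ₂ (G.end₂ e)) (v : V₁) (w : V₂) : φ₁ v = φ₂ w := by
  have hadj : ∀ x y, G.toSimpleGraph.Adj x y → Sum.elim φ₁ φ₂ x = Sum.elim φ₁ φ₂ y := by
    intro x y hxy
    rcases (SimpleGraph.fromRel_adj _ _ _).1 hxy with ⟨-, ⟨e, rfl, rfl⟩ | ⟨e, rfl, rfl⟩⟩
    exacts [h e, (h e).symm]
  have hwalk : ∀ x y, G.toSimpleGraph.Walk x y → Sum.elim φ₁ φ₂ x = Sum.elim φ₁ φ₂ y := by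
    intro x y p
    induction p with
    | nil => rfl
    | cons hxy _ ih => exact (hadj _ _ hxy).trans ih
  obtain ⟨p⟩ := SimpleGraph.Connected.preconnected hG (Sum.inl v) (Sum.inr w)
  exact hwalk _ _ p

omit [T2Space S] [CompactSpace S] [IsManifold (𝓡 2) ∞ S] in
/-- A function which is constant on connected sets off the curves takes at the basepoint of an
edge its value at the centre of the star. -/
lemma Stars.eq_center {d : ℕ} {γ : Fin d → Circle → S} {V E : Type} {endpt : E → V} {z : E → S}
    (T : Stars γ endpt z) {X : Type*} {f : S → X}
    (hf : ∀ s ⊆ (curveUnion γ)ᶜ, _root_.IsPreconnected s → ∀ p ∈ s, ∀ q ∈ s, f p = f q) (e : E) :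
    f (z e) = f (T.center (endpt e)) := by
  have h0 : (0 : ℝ) ∈ Icc (0 : ℝ) 1 := by simp
  have h1 : (1 : ℝ) ∈ Icc (0 : ℝ) 1 := by simp
  refine hf (T.leg e '' Icc 0 1) ?_ (isPreconnected_Icc.image _ (T.leg_smooth e).smooth.continuousOn)
    _ ⟨1, h1, T.leg_one e⟩ _ ⟨0, h0, T.leg_zero e⟩
  rintro _ ⟨s, hs, rfl⟩
  exact T.leg_off e s hs

omit [T2Space S] [CompactSpace S] [IsManifold (𝓡 2) ∞ S] in
/-- A function which is constant on connected sets off the curves takes everywhere off the curves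
its value at the centre of some star. -/
lemma Stars.exists_eq_center {d : ℕ} {γ : Fin d → Circle → S} {V E : Type} {endpt : E → V}
    {z : E → S} (T : Stars γ endpt z) {X : Type*} {f : S → X}
    (hf : ∀ s ⊆ (curveUnion γ)ᶜ, _root_.IsPreconnected s → ∀ p ∈ s, ∀ q ∈ s, f p = f q) {p : S}
    (hp : p ∉ curveUnion γ) : ∃ v, f p = f (T.center v) := by
  obtain ⟨v, hv, -⟩ := T.component p hp
  refine ⟨v, hf _ (connectedComponentIn_subset _ _) isPreconnected_connectedComponentIn _ hv _ ?_⟩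
  -- `connectedComponentIn` is empty for a base point outside the set, so containing p places the
  -- centre off the curves.
  exact mem_connectedComponentIn (connectedComponentIn_nonempty_iff.1 ⟨p, hv⟩)

/-- If `H₁(M) = 0` and the graph is connected, a Heegaard diagram has no non-zero periodic
domains. -/
theorem HeegaardPresentation.eq_zero_of_isPeriodic [ConnectedSpace S] (hM : Limits.IsZero (H1 M))
    {d₁ d₂ m : ℕ} {D : PointedDiagram S d₁ d₂ m} {oM : ManifoldOrientation 3 M} {V₁ V₂ E : Type}
    [Fintype V₁] [Fintype V₂] {G : SpatialGraph V₁ V₂ E M} (hG : G.toBipartiteGraph.IsConnected)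
    {g : ℕ} (H : HeegaardPresentation D oM G g) {P : D.Domain} (hP : D.IsPeriodic P) : P = 0 := by
  obtain ⟨fα, fβ, hα, hβ, hsub⟩ := H.exists_mult_eq_sub hM hP
  have hedge : ∀ e, fα (H.stars₁.center (G.end₁ e)) = fβ (H.stars₂.center (G.end₂ e)) := by
    intro e
    have h := hsub (D.z (H.label e)) (D.z_mem _)
    rw [hP.basepoints, Int.cast_zero] at h
    rw [← H.stars₁.eq_center hα e, ← H.stars₂.eq_center hβ e]
    linarith
  have hzero : ∀ p ∈ D.complement, D.mult P p = 0 := by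
    intro p hp
    obtain ⟨v, hv⟩ := H.stars₁.exists_eq_center hα fun h => hp (Or.inl h)
    obtain ⟨w, hw⟩ := H.stars₂.exists_eq_center hβ fun h => hp (Or.inr h)
    have h := hsub p hp
    rw [hv, hw, hG.eq_of_edges (φ₁ := fun v => fα (H.stars₁.center v))
      (φ₂ := fun w => fβ (H.stars₂.center w)) hedge v w, sub_self] at h
    exact_mod_cast h
  funext x
  obtain ⟨⟨p, hp⟩, rfl⟩ := ConnectedComponents.surjective_coe x
  have := hzero p hp
  rwa [PointedDiagram.mult, dif_pos hp] at this

end Periodic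

end SpatialHeegaard

end

theorem mainTheorem7
    {M : Type*} [TopologicalSpace M] [T2Space M] [CompactSpace M]
    [ChartedSpace (EuclideanSpace ℝ (Fin 3)) M] [IsManifold (𝓡 3) ∞ M]
    (oM : SpatialHeegaard.ManifoldOrientation 3 M)
    (hM : CategoryTheory.Limits.IsZero (SpatialHeegaard.H1 M))
    {V₁ V₂ E : Type} [Fintype V₁] [Fintype V₂] [Fintype E]
    (G : SpatialHeegaard.SpatialGraph V₁ V₂ E M)
    (hbalanced : Fintype.card V₁ = Fintype.card V₂)
    (hG : G.toBipartiteGraph.IsConnected)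
    {S : Type*} [TopologicalSpace S] [T2Space S] [CompactSpace S] [ConnectedSpace S]
    [ChartedSpace (EuclideanSpace ℝ (Fin 2)) S] [IsManifold (𝓡 2) ∞ S]
    {d₁ d₂ m : ℕ} (D : SpatialHeegaard.PointedDiagram S d₁ d₂ m)
    (hD : SpatialHeegaard.IsHeegaardDiagram D oM G) :
    (∀ P : D.Domain, D.IsPeriodic P → P = 0) ∧ D.IsAdmissible := by
  obtain ⟨g, ⟨H⟩⟩ := hD
  have h : ∀ P : D.Domain, D.IsPeriodic P → P = 0 := fun P hP => H.eq_zero_of_isPeriodic hM hG hP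
  -- Admissibility is vacuous once every periodic domain vanishes.
  exact ⟨h, fun P hP hne => absurd (h P hP) hne⟩
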